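/- Let $M\ge 1$ be an integer. An expansion of $x\in\mathbb R$ in base $q>1$ is a sequence $(c_i)_{i\ge1}\in\{0,\dots,M\}^{\mathbb N}$ with $\sum_{i\ge1} c_i q^{-i}=x$. A sequence is called infinite if it has infinitely many nonzero digits or is identically zero, and doubly infinite if both $(c_i)$ and $(M-c_i)$ are infinite. Let $\mathcal U$ (respectively $\mathcal V$) be the set of bases $q>1$ in which $x=1$ has a unique expansion (respectively a unique doubly infinite expansion), and let $\overline{\mathcal U}$ be the topological closure of $\mathcal U$. For $q\in\mathcal V\setminus\mathcal U$ the lexicographically largest expansion of $1$ in base $q$ has the form $\beta_1\cdots\beta_N0^\infty$ with $\beta_N\neq0$. Put $a_i=\sum_{k=i}^{N}\beta_k q^{-(k-i+1)}$ and $b_i=\frac{M}{q-1}-a_i$ for $1\le i\le N$, and $S_q=\bigcup_{j=1}^M\left[\frac jq,\frac{j-1}q+\frac M{q^2-q}\right]$. Let $\mathcal G(q)$ be the labeled directed graph whose vertices are the connected components (disjoint open intervals) of $$\left(0,\tfrac{M}{q-1}\right)\setminus\left(S_q\cup\{a_1,\dots,a_N,b_1,\dots,b_N\}\right),$$ and whose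 edges are the triplets $(I,k,J)$ with vertices $I,J$ and label $k\in\{0,\dots,M\}$ such that $T_k(I)\supset J$, where $T_k(x)=qx-k$. **Theorem.** Let $(q_0,q_0^*)$ be a connected component of $(1,M+1)\setminus\overline{\mathcal U}$ with $q_0>1$ (so that $q_0\in\overline{\mathcal U}\setminus\mathcal U\subset\mathcal V\setminus\mathcal U$ and $\mathcal G(q_0)$ is defined), and let $q_1$ be the smallest element of $\mathcal V$ in $(q_0,q_0^*)$. Then the labeled graphs $\mathcal G(q_0)$ and $\mathcal G(q_1)$ are isomorphic: there is a bijection $F$ between their vertex sets such that $(I,k,J)$ is an edge of $\mathcal G(q_0)$ if and only if $(F(I),k,F(J))$ is an edge of $\mathcal G(q_1)$, for all vertices $I,J$ and all labels $k$. Moreover, $F$ can be chosen of the form $F((x,y))=(f(x),f(y))$, where $f$ is an increasing bijection from the set of endpoints of the interval-vertices of $\mathcal G(q_0)$ onto the set of endpoints of the interval-vertices of $\mathcal G(q_1)$. -/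

import Mathlib

namespace Univoque

/-- Sequences over the alphabet `{0, …, M}`; the digit `c_i` of the usual notation (`i ≥ 1`)
is `c (i - 1)`. -/
abbrev DigitSeq (M : ℕ) : Type := ℕ → Fin (M + 1)

/-- `c` is an expansion of `x` in base `q`: `x = ∑_{i ≥ 1} c_i / q ^ i`. -/
def IsExpansion {M : ℕ} (q x : ℝ) (c : DigitSeq M) : Prop :=
  HasSum (fun i : ℕ => ((c i : ℕ) : ℝ) / q ^ (i + 1)) x

/-- A sequence is infinite if it has infinitely many nonzero digits or is identically zero. -/
def IsInfinite {M : ℕ} (c : DigitSeq M) : Prop :=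
  {i : ℕ | c i ≠ 0}.Infinite ∨ ∀ i, c i = 0

/-- The reflection `(M - c_i)` of a sequence. -/
def reflect {M : ℕ} (c : DigitSeq M) : DigitSeq M := fun i => (c i).rev

/-- Both the sequence and its reflection are infinite. -/
def IsDoublyInfinite {M : ℕ} (c : DigitSeq M) : Prop :=
  IsInfinite c ∧ IsInfinite (reflect c)

/-- The bases `q > 1` in which `1` has a unique expansion. -/
def setU (M : ℕ) : Set ℝ :=
  {q | 1 < q ∧ ∃! c : DigitSeq M, IsExpansion q 1 c}

/-- The bases `q > 1` in which `1` has a unique doubly infinite expansion. -/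
def setV (M : ℕ) : Set ℝ :=
  {q | 1 < q ∧ ∃! c : DigitSeq M, IsExpansion q 1 c ∧ IsDoublyInfinite c}

/-- `(l, r)` is a connected component of `(1, M + 1) ∖ closure U`. -/
def IsGap (M : ℕ) (l r : ℝ) : Prop :=
  ∃ x ∈ Set.Ioo (1 : ℝ) (M + 1) \ closure (setU M),
    connectedComponentIn (Set.Ioo (1 : ℝ) (M + 1) \ closure (setU M)) x = Set.Ioo l r

/-- `c` is the greedy, i.e. lexicographically largest, expansion of `x` in base `q`. -/
def IsGreedy {M : ℕ} (q x : ℝ) (c : DigitSeq M) : Prop :=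
  IsExpansion q x c ∧ ∀ d : DigitSeq M, IsExpansion q x d → toLex d ≤ toLex c

/-- The switch region: the union of the intervals
`[j / q, (j - 1) / q + M / (q ^ 2 - q)]` for `j = 1, …, M`. -/
def switchRegion (M : ℕ) (q : ℝ) : Set ℝ :=
  {x | ∃ j : ℕ, 1 ≤ j ∧ j ≤ M ∧
    x ∈ Set.Icc ((j : ℝ) / q) (((j : ℝ) - 1) / q + (M : ℝ) / (q ^ 2 - q))}

/-- The points `a_1, …, a_N`, where `β_1 ⋯ β_N 0^∞` with `β_N ≠ 0` is the greedy expansion of `1`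
in base `q`, and `a_i` is the number with expansion `β_i ⋯ β_N 0^∞`.
The condition `i ≤ N` says that some digit from the `i`-th one on is nonzero. -/
def aPoints (M : ℕ) (q : ℝ) : Set ℝ :=
  {x | ∃ (c : DigitSeq M) (i : ℕ), IsGreedy q 1 c ∧ (∃ k, i ≤ k ∧ c k ≠ 0) ∧
    IsExpansion q x (fun k => c (i + k))}

/-- The reflected points `b_i = M / (q - 1) - a_i`, for `i = 1, …, N`. -/
def bPoints (M : ℕ) (q : ℝ) : Set ℝ :=
  {x | ∃ a ∈ aPoints M q, x = (M : ℝ) / (q - 1) - a}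

/-- The set whose connected components are the vertices of the graph. -/
def vertexRegion (M : ℕ) (q : ℝ) : Set ℝ :=
  Set.Ioo 0 ((M : ℝ) / (q - 1)) \ (switchRegion M q ∪ aPoints M q ∪ bPoints M q)

/-- Directed graphs with edges labeled by elements of `L`; an edge is a triplet. -/
structure LabeledGraph (L : Type) where
  Vertex : Type
  Edge : Vertex → L → Vertex → Prop

/-- Isomorphisms of labeled directed graphs: bijections between the vertices that preserve and
reflect the labeled edges. -/
structure LabeledGraph.Iso {L : Type} (G H : LabeledGraph L) where
  toEquiv : G.Vertex ≃ H.Vertex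
  edge_iff : ∀ (I : G.Vertex) (k : L) (J : G.Vertex),
    G.Edge I k J ↔ H.Edge (toEquiv I) k (toEquiv J)

/-- The labeled graph `𝒢(q)`: the vertices are the connected components of `vertexRegion M q`,
and `(I, k, J)` is an edge if `T_k(I) ⊇ J`, where `T_k(x) = q x - k`. -/
def graph (M : ℕ) (q : ℝ) : LabeledGraph (Fin (M + 1)) where
  Vertex := {C : Set ℝ // ∃ x ∈ vertexRegion M q, connectedComponentIn (vertexRegion M q) x = C}
  Edge I k J := J.1 ⊆ (fun x : ℝ => q * x - ((k : ℕ) : ℝ)) '' I.1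

/-- The set of the left and right endpoints of the interval-vertices of `𝒢(q)`. -/
def endpoints (M : ℕ) (q : ℝ) : Set ℝ :=
  {x | ∃ I : (graph M q).Vertex, IsGLB I.1 x ∨ IsLUB I.1 x}

end Univoque

/-! For 1 < q < M + 1, membership of q in V means that 1 has an expansion α(q) for which neither a
tail nor the reflection of a tail is lexicographically larger than α(q) (`Adm`, `IsAlpha`). The
sequence α(q) increases strictly with q, and by the intermediate value theorem an admissible
sequence strictly between two of them is α(p) for some p of V in between (`no_adm_between`). Since
q₀ lies in the closure of U, no tail of α(q₀) is the reflection of α(q₀)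
(`exists_isAlpha_of_mem_closure`). As V has no element between q₀ and q₁, there is a word w of
length n with α(q₁) = (w w̄)^∞ and α(q₀) = (w⁻)^∞, where w⁻ is w with its last digit lowered by one
(`exists_word`); otherwise a truncation of α(q₁) would be admissible and lie strictly in between.

Follow 1 along w by x ↦ qx - w_i. In both bases the orbit stays strictly between M/(q-1) - 1 and 1
at the times 0 < i < n; at time n it reaches 0 in base q₀ and M/(q₁-1) - 1 in base q₁. So the greedy
expansions of 1 are w 0^∞ and w w̄⁺ 0^∞, and in both bases the a_i and b_i together are the n orbit
points and their reflections.

Apart from 0 and M/(q-1), every endpoint of a vertex is the preimage under some T_k of an orbit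
point or of a reflected one. This gives it a name independent of the base (`Label`), and backward
induction along w shows that names are ordered alike in the two bases (`eval_le_iff`). The last
orbit point and its reflection have no name of their own: each is one end of a switch interval in
base q₀ and the other end of the corresponding interval in base q₁. No vertex meets a switch
interval, so edges still depend only on the order of the names (`IsGraphBase.edge_iff`), and
matching names gives the isomorphism (`exists_iso_of_eval_le_iff`). -/

namespace Univoque

variable {M : ℕ} {q : ℝ}

/-! ### Digit sequences, their values and the lexicographic order -/

/-- The sequence obtained by deleting the first `i` digits. -/
def shift (i : ℕ) (c : DigitSeq M) : DigitSeq M := fun k => c (i + k)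

/-- The real number with digit sequence `c` in base `q`. -/
noncomputable def val (q : ℝ) (c : DigitSeq M) : ℝ := ∑' i, ((c i : ℕ) : ℝ) / q ^ (i + 1)

@[simp] lemma shift_apply (i k : ℕ) (c : DigitSeq M) : shift i c k = c (i + k) := rfl

@[simp] lemma shift_zero (c : DigitSeq M) : shift 0 c = c := by
  funext k; simp

@[simp] lemma shift_shift (i j : ℕ) (c : DigitSeq M) : shift i (shift j c) = shift (j + i) c := by
  funext k; simp [add_assoc]

lemma digit_le (c : DigitSeq M) (i : ℕ) : (c i : ℕ) ≤ M := Nat.lt_succ_iff.mp (c i).2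

lemma reflect_val (c : DigitSeq M) (i : ℕ) : ((reflect c i : Fin (M + 1)) : ℕ) = M - c i := by
  simp [reflect, Fin.val_rev]

@[simp] lemma reflect_reflect (c : DigitSeq M) : reflect (reflect c) = c := by
  funext k; simp [reflect]

lemma reflect_shift (i : ℕ) (c : DigitSeq M) : reflect (shift i c) = shift i (reflect c) := rfl

lemma hasSum_geometric_digits (hq : 1 < q) (M : ℕ) :
    HasSum (fun i : ℕ => (M : ℝ) / q ^ (i + 1)) ((M : ℝ) / (q - 1)) := by
  have h := (hasSum_geometric_of_lt_one (r := q⁻¹) (by positivity) (inv_lt_one_of_one_lt₀ hq)).mul_left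
    ((M : ℝ) / q)
  have hq0 : q ≠ 0 := by positivity
  have hq1 : q - 1 ≠ 0 := by linarith
  have h1 : (fun i : ℕ => (M : ℝ) / q ^ (i + 1)) = fun i => (M : ℝ) / q * q⁻¹ ^ i := by
    funext i
    rw [inv_pow, pow_succ]
    field_simp
  have h2 : (M : ℝ) / (q - 1) = (M : ℝ) / q * (1 - q⁻¹)⁻¹ := by
    have : 1 - q⁻¹ = (q - 1) / q := by field_simp
    rw [this]
    field_simp
  rw [h1, h2]
  exact h

lemma summable_digits (hq : 1 < q) (c : DigitSeq M) :
    Summable (fun i : ℕ => ((c i : ℕ) : ℝ) / q ^ (i + 1)) := by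
  refine Summable.of_nonneg_of_le (fun i => by positivity) (fun i => ?_)
    (hasSum_geometric_digits hq M).summable
  have : ((c i : ℕ) : ℝ) ≤ M := by exact_mod_cast digit_le c i
  gcongr

lemma isExpansion_iff (hq : 1 < q) {x : ℝ} {c : DigitSeq M} : IsExpansion q x c ↔ val q c = x :=
  ⟨fun h => h.tsum_eq, fun h => h ▸ (summable_digits hq c).hasSum⟩

lemma val_shift_succ (hq : 1 < q) (c : DigitSeq M) (i : ℕ) :
    val q (shift (i + 1) c) = q * val q (shift i c) - (c i : ℕ) := by
  have hq0 : q ≠ 0 := by positivity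
  have h := (summable_digits hq (shift i c)).tsum_eq_zero_add
  have h2 : ∑' j : ℕ, ((shift i c (j + 1) : ℕ) : ℝ) / q ^ (j + 1 + 1)
      = q⁻¹ * val q (shift (i + 1) c) := by
    rw [val, ← tsum_mul_left]
    congr 1
    funext j
    rw [shift_apply, shift_apply, show i + (j + 1) = i + 1 + j by ring, pow_succ _ (j + 1)]
    field_simp
  rw [h2] at h
  change val q (shift i c) = _ at h
  rw [h]
  simp
  field_simp
  ring

lemma val_nonneg (hq : 1 < q) (c : DigitSeq M) : 0 ≤ val q c :=
  tsum_nonneg fun i => by positivity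

lemma val_reflect (hq : 1 < q) (c : DigitSeq M) :
    val q (reflect c) = (M : ℝ) / (q - 1) - val q c := by
  have h := (hasSum_geometric_digits hq M).sub (summable_digits hq c).hasSum
  change HasSum _ ((M : ℝ) / (q - 1) - val q c) at h
  rw [← h.tsum_eq]
  refine tsum_congr fun i => ?_
  rw [reflect_val, Nat.cast_sub (digit_le c i)]
  ring

lemma val_le_top (hq : 1 < q) (c : DigitSeq M) : val q c ≤ (M : ℝ) / (q - 1) := by
  have := val_nonneg hq (reflect c)
  rw [val_reflect hq] at this
  linarith

lemma val_pos (hq : 1 < q) {c : DigitSeq M} (h : ∃ i, c i ≠ 0) : 0 < val q c := by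
  obtain ⟨i, hi⟩ := h
  refine (summable_digits hq c).tsum_pos (fun j => by positivity) i ?_
  have : 0 < (c i : ℕ) := Nat.pos_of_ne_zero fun h => hi (Fin.ext h)
  positivity

lemma pow_mul_val_sub (hq : 1 < q) {c d : DigitSeq M} (j : ℕ) (h : ∀ i < j, c i = d i) :
    q ^ j * (val q c - val q d) = val q (shift j c) - val q (shift j d) := by
  induction j with
  | zero => simp
  | succ j ih =>
    rw [val_shift_succ hq, val_shift_succ hq, h j (by omega), pow_succ, mul_comm _ q, mul_assoc,
      ih fun i hi => h i (by omega)]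
    ring

/-- Digits along a bounded orbit of the maps `x ↦ q x - k` give an expansion. -/
lemma val_eq_of_orbit (hq : 1 < q) {c : DigitSeq M} {t : ℕ → ℝ} {K : ℝ}
    (ht : ∀ i, t (i + 1) = q * t i - (c i : ℕ)) (hK : ∀ i, |t i| ≤ K) (i : ℕ) :
    val q (shift i c) = t i := by
  -- Both orbits obey the same recursion, so their distance is multiplied by q at each step; both
  -- are bounded, so it vanishes.
  have key : ∀ m, val q (shift m c) - t m = q ^ m * (val q c - t 0) := by
    intro m
    induction m with
    | zero => simp
    | succ m ih =>
      rw [val_shift_succ hq, ht, pow_succ, mul_comm _ q, mul_assoc, ← ih]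
      ring
  have h0 : val q c - t 0 = 0 := by
    by_contra hne
    have hpos : 0 < |val q c - t 0| := abs_pos.mpr hne
    obtain ⟨m, hm⟩ := pow_unbounded_of_one_lt (((M : ℝ) / (q - 1) + K) / |val q c - t 0|) hq
    rw [div_lt_iff₀ hpos] at hm
    have h1 : q ^ m * |val q c - t 0| = |val q (shift m c) - t m| := by
      rw [key, abs_mul, abs_of_pos (by positivity : 0 < q ^ m)]
    have h2 := abs_sub (val q (shift m c)) (t m)
    have h3 := hK m
    have h4 := val_le_top hq (shift m c)
    rw [abs_of_nonneg (val_nonneg hq (shift m c))] at h2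
    linarith
  have := key i
  rw [h0, mul_zero] at this
  linarith

lemma val_eq_of_agree (hq : 1 < q) {c d : DigitSeq M} (j : ℕ) (h : ∀ i < j, c i = d i)
    (h' : val q (shift j c) = val q (shift j d)) : val q c = val q d := by
  have := pow_mul_val_sub hq j h
  rw [h', sub_self] at this
  have hp : q ^ j ≠ 0 := by positivity
  have := (mul_eq_zero.mp this).resolve_left hp
  linarith

lemma lex_lt_iff {c d : DigitSeq M} :
    toLex c < toLex d ↔ ∃ j, (∀ i < j, c i = d i) ∧ c j < d j := Iff.rfl

lemma exists_first_diff {c d : DigitSeq M} (h : c ≠ d) :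
    ∃ j, (∀ i < j, c i = d i) ∧ c j ≠ d j := by
  classical
  have h' : ∃ j, c j ≠ d j := Function.ne_iff.mp h
  exact ⟨Nat.find h', fun i hi => not_not.mp (Nat.find_min h' hi), Nat.find_spec h'⟩

lemma one_le_sub_of_lt {a b : Fin (M + 1)} (h : a < b) : ((a : ℕ) : ℝ) + 1 ≤ (b : ℕ) := by
  have : (a : ℕ) + 1 ≤ b := h
  exact_mod_cast this

lemma reflect_lt_reflect {c d : DigitSeq M} (h : toLex c < toLex d) :
    toLex (reflect d) < toLex (reflect c) := by
  obtain ⟨j, hj, hlt⟩ := lex_lt_iff.mp h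
  exact lex_lt_iff.mpr ⟨j, fun i hi => by simp [reflect, hj i hi], by simpa [reflect] using hlt⟩

lemma reflect_le_reflect {c d : DigitSeq M} (h : toLex c ≤ toLex d) :
    toLex (reflect d) ≤ toLex (reflect c) := by
  by_contra hlt
  have := reflect_lt_reflect (not_le.mp hlt)
  simp only [reflect_reflect] at this
  exact absurd h (not_le.mpr this)

/-- Lexicographic order and the order of values agree if the tails of the smaller sequence are
at most one. -/
lemma val_lt_val (hq : 1 < q) {c d : DigitSeq M} (h : toLex d < toLex c)
    (hd : ∀ i, 1 ≤ i → val q (shift i d) ≤ 1) (hc : ∀ i, 0 < val q (shift i c)) :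
    val q d < val q c := by
  obtain ⟨j, hj, hlt⟩ := lex_lt_iff.mp h
  have h1 := pow_mul_val_sub hq j hj
  have h2 := val_shift_succ hq c j
  have h3 := val_shift_succ hq d j
  have h4 := one_le_sub_of_lt hlt
  have h5 := hd (j + 1) (by omega)
  have h6 := hc (j + 1)
  have hp : 0 < q ^ j := by positivity
  have h7 : q * (q ^ j * (val q d - val q c)) < 0 := by rw [h1]; linarith
  have hq0 : 0 < q := by linarith
  by_contra hge
  have : 0 ≤ q * (q ^ j * (val q d - val q c)) :=
    mul_nonneg hq0.le (mul_nonneg hp.le (by linarith))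
  linarith

/-- If a shift invariant family is lexicographically bounded by an expansion of a number at most
one, then its members have values at most one. -/
lemma val_le_one (hq : 1 < q) {c : DigitSeq M} (hc : val q c ≤ 1) (D : Set (DigitSeq M))
    (hD : ∀ d ∈ D, ∀ i, shift i d ∈ D) (hle : ∀ d ∈ D, toLex d ≤ toLex c) :
    ∀ d ∈ D, val q d ≤ 1 := by
  have hK : 0 ≤ (M : ℝ) / (q - 1) := div_nonneg (by positivity) (by linarith)
  have hq0 : 0 < q := by linarith
  -- The possible excess over 1 shrinks by a factor q with each m: at the first difference the digit
  -- of c leads by at least one, which absorbs the 1 in the bound for the tail of d.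
  have key : ∀ m : ℕ, ∀ d ∈ D, val q d ≤ 1 + (M : ℝ) / (q - 1) / q ^ m := by
    intro m
    induction m with
    | zero =>
      intro d _
      have := val_le_top hq d
      simp
      linarith
    | succ m ih =>
      intro d hd
      have hpos : 0 ≤ (M : ℝ) / (q - 1) / q ^ (m + 1) := by positivity
      rcases (hle d hd).lt_or_eq with h | h
      · obtain ⟨j, hj, hlt⟩ := lex_lt_iff.mp h
        have h1 := pow_mul_val_sub hq j hj
        have h2 := val_shift_succ hq c j
        have h3 := val_shift_succ hq d j
        have h4 := one_le_sub_of_lt hlt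
        have h5 := ih _ (hD d hd (j + 1))
        have h6 := val_nonneg hq (shift (j + 1) c)
        have h7 : q * (q ^ j * (val q d - val q c)) ≤ (M : ℝ) / (q - 1) / q ^ m := by
          rw [h1]; linarith
        by_contra hcon
        have h8 : (M : ℝ) / (q - 1) / q ^ (m + 1) < val q d - val q c := by linarith
        have h9 : val q d - val q c ≤ q ^ j * (val q d - val q c) :=
          le_mul_of_one_le_left (by linarith) (one_le_pow₀ hq.le)
        have h10 : q * ((M : ℝ) / (q - 1) / q ^ (m + 1)) < q * (q ^ j * (val q d - val q c)) :=
          mul_lt_mul_of_pos_left (by linarith) hq0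
        have h11 : q * ((M : ℝ) / (q - 1) / q ^ (m + 1)) = (M : ℝ) / (q - 1) / q ^ m := by
          rw [pow_succ]; field_simp
        linarith
      · rw [toLex_inj.mp h]; linarith
  intro d hd
  have hlim : Filter.Tendsto (fun m : ℕ => 1 + (M : ℝ) / (q - 1) / q ^ m) Filter.atTop
      (nhds (1 + 0)) :=
    tendsto_const_nhds.add ((tendsto_pow_atTop_atTop_of_one_lt hq).const_div_atTop _)
  rw [add_zero] at hlim
  exact ge_of_tendsto' hlim fun m => key m d hd

lemma val_strictAnti {p : ℝ} (hp : 1 < p) (hpq : p < q) {c : DigitSeq M} (h : ∃ i, c i ≠ 0) :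
    val q c < val p c := by
  obtain ⟨i, hi⟩ := h
  have hpos : 0 < (c i : ℕ) := Nat.pos_of_ne_zero fun h => hi (Fin.ext h)
  refine Summable.tsum_lt_tsum (i := i) (fun j => ?_) ?_ (summable_digits (hp.trans hpq) c)
    (summable_digits hp c)
  · gcongr
  · have : (0 : ℝ) < (c i : ℕ) := by exact_mod_cast hpos
    gcongr

lemma continuousOn_val {p : ℝ} (hp : 1 < p) (c : DigitSeq M) :
    ContinuousOn (fun q => val q c) (Set.Ici p) := by
  refine continuousOn_tsum (u := fun i => (M : ℝ) / p ^ (i + 1)) (fun i => ?_)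
    (hasSum_geometric_digits hp M).summable (fun i x hx => ?_)
  · refine continuousOn_const.div (continuousOn_pow _) fun x hx => ?_
    have : 0 < x := by linarith [Set.mem_Ici.mp hx]
    positivity
  · have hx : p ≤ x := hx
    have hx0 : 0 < x := by linarith
    rw [Real.norm_of_nonneg (by positivity)]
    have : ((c i : ℕ) : ℝ) ≤ M := by exact_mod_cast digit_le c i
    gcongr

/-! ### Admissible sequences -/

/-- The lexicographic conditions that characterize the doubly infinite expansions of `1` in the
bases belonging to `V`. -/
structure Adm (c : DigitSeq M) : Prop where
  shift_le : ∀ i, toLex (shift i c) ≤ toLex c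
  reflect_le : ∀ i, toLex (reflect (shift i c)) ≤ toLex c

lemma lex_lt_shift_iff {c d : DigitSeq M} {n : ℕ} (h : ∀ i < n, c i = d i) :
    toLex c < toLex d ↔ toLex (shift n c) < toLex (shift n d) := by
  simp only [lex_lt_iff, shift_apply]
  constructor
  · rintro ⟨j, hj, hlt⟩
    have hnj : n ≤ j := by
      by_contra hjn
      exact absurd (h j (by omega)) hlt.ne
    exact ⟨j - n, fun i hi => hj _ (by omega), by rwa [Nat.add_sub_cancel' hnj]⟩
  · rintro ⟨j, hj, hlt⟩
    refine ⟨n + j, fun i hi => ?_, hlt⟩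
    by_cases hin : i < n
    · exact h i hin
    · have := hj (i - n) (by omega)
      rwa [Nat.add_sub_cancel' (not_lt.mp hin)] at this

lemma lex_le_shift_iff {c d : DigitSeq M} {n : ℕ} (h : ∀ i < n, c i = d i) :
    toLex c ≤ toLex d ↔ toLex (shift n c) ≤ toLex (shift n d) :=
  not_lt.symm.trans ((not_congr (lex_lt_shift_iff fun i hi => (h i hi).symm)).trans not_lt)

lemma eq_of_shift_eq {c d : DigitSeq M} {n : ℕ} (h : ∀ i < n, c i = d i)
    (h' : shift n c = shift n d) : c = d := by
  funext i
  by_cases hin : i < n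
  · exact h i hin
  · have := congrFun h' (i - n)
    simpa [Nat.add_sub_cancel' (not_lt.mp hin)] using this

lemma Adm.le_shift {c : DigitSeq M} (hc : Adm c) (i : ℕ) :
    toLex (reflect c) ≤ toLex (shift i c) := by
  simpa using reflect_le_reflect (hc.reflect_le i)

lemma digit_le_of_lex_le {c d : DigitSeq M} (h : toLex c ≤ toLex d) : c 0 ≤ d 0 := by
  by_contra hlt
  exact absurd h (not_le.mpr (lex_lt_iff.mpr ⟨0, by simp, not_le.mp hlt⟩))

/-- The condition for the zeroth shift follows from the other ones. -/
lemma Adm.of_pos {c : DigitSeq M} (h₁ : ∀ i, toLex (shift i c) ≤ toLex c)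
    (h₂ : ∀ i, 1 ≤ i → toLex (reflect (shift i c)) ≤ toLex c) : Adm c := by
  refine ⟨h₁, fun i => ?_⟩
  rcases Nat.eq_zero_or_pos i with rfl | hi
  · rw [shift_zero]
    -- All later digits lie between M - c 0 and c 0, so 2 c 0 ≥ M. If c agrees with its reflection
    -- before some j ≥ 1, then c 0 = M/2, which forces c j = M/2 as well.
    have hmax : ∀ i, (c i : ℕ) ≤ c 0 := fun i => by simpa using digit_le_of_lex_le (h₁ i)
    have hmin : ∀ i, 1 ≤ i → M - (c i : ℕ) ≤ c 0 := fun i hi => by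
      have : ((reflect (shift i c) 0 : Fin (M + 1)) : ℕ) ≤ c 0 := digit_le_of_lex_le (h₂ i hi)
      simpa [reflect_val] using this
    by_contra hlt
    obtain ⟨j, hj, hlt⟩ := lex_lt_iff.mp (not_le.mp hlt)
    have hlt : (c j : ℕ) < (reflect c j : Fin (M + 1)) := hlt
    rw [reflect_val] at hlt
    have hd := digit_le c j
    rcases Nat.eq_zero_or_pos j with rfl | hjp
    · have h3 := hmin 1 le_rfl
      have h4 := hmax 1
      omega
    · have h0 := congrArg Fin.val (hj 0 hjp)
      rw [reflect_val] at h0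
      have h3 := hmin j hjp
      have h4 := hmax j
      have := digit_le c 0
      omega
  · exact h₂ i hi

/-- Otherwise c = reflect c < reflect d ≤ d < c. -/
lemma Adm.ne_of_lt {c d : DigitSeq M} (hd : Adm d) (h : toLex d < toLex c) : c ≠ reflect c := by
  intro hc
  have h1 := reflect_lt_reflect h
  rw [← hc] at h1
  have h2 := hd.reflect_le 0
  rw [shift_zero] at h2
  exact absurd (h1.trans (h2.trans_lt h)) (lt_irrefl _)

/-- If a tail of `c` is the reflection of `c`, then a smaller admissible sequence has to differ
from `c` before this tail. -/
lemma Adm.not_agree {c d : DigitSeq M} (hd : Adm d) (h : toLex d < toLex c) {n : ℕ}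
    (hn : shift n c = reflect c) : ¬ ∀ i < n, d i = c i := by
  intro hag
  have h1 := (lex_lt_shift_iff hag).mp h
  rw [hn] at h1
  exact absurd (h1.trans (reflect_lt_reflect h)) (not_lt.mpr (hd.le_shift n))

/-! ### Truncation of admissible sequences to periodic ones -/

/-- The periodic sequence whose period is obtained from the first `n` digits of `c` by decreasing
the last one. -/
def trunc (n : ℕ) (c : DigitSeq M) : DigitSeq M := fun i =>
  if i % n = n - 1 then ⟨(c (n - 1) : ℕ) - 1, by have := (c (n - 1)).2; omega⟩ else c (i % n)

section trunc
variable {n : ℕ} {c : DigitSeq M}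

lemma trunc_of_lt {i : ℕ} (hi : i < n - 1) : trunc n c i = c i := by
  have h1 : i % n = i := Nat.mod_eq_of_lt (by omega)
  rw [trunc, if_neg (by omega), h1]

lemma trunc_last (hn : 1 ≤ n) (h0 : c (n - 1) ≠ 0) :
    (trunc n c (n - 1) : ℕ) + 1 = c (n - 1) := by
  have h1 : (n - 1) % n = n - 1 := Nat.mod_eq_of_lt (by omega)
  have : 0 < (c (n - 1) : ℕ) := Nat.pos_of_ne_zero fun h => h0 (Fin.ext h)
  rw [trunc, if_pos h1]
  simp only
  omega

lemma trunc_last_lt (hn : 1 ≤ n) (h0 : c (n - 1) ≠ 0) : trunc n c (n - 1) < c (n - 1) := by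
  have := trunc_last hn h0
  exact Fin.lt_def.mpr (by omega)

lemma shift_trunc : shift n (trunc n c) = trunc n c := by
  funext i
  simp [trunc]

lemma shift_mod_trunc (i : ℕ) : shift i (trunc n c) = shift (i % n) (trunc n c) := by
  funext k
  simp [trunc]

lemma trunc_lt (hn : 1 ≤ n) (h0 : c (n - 1) ≠ 0) : toLex (trunc n c) < toLex c :=
  lex_lt_iff.mpr ⟨n - 1, fun _ hi => trunc_of_lt hi, trunc_last_lt hn h0⟩

/-- If c overlaps with its shift up to the end of the word, lowering the last digit makes the shift
strictly smaller there. Otherwise the shift of c is already smaller at a place inside the word, and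
lowering a digit of it does no harm. -/
lemma shift_trunc_lt (hc : Adm c) (h0 : c (n - 1) ≠ 0) {i : ℕ} (hi : 1 ≤ i) (hin : i < n) :
    toLex (shift i (trunc n c)) < toLex (trunc n c) := by
  by_cases hag : ∀ j < n - i, c (i + j) = c j
  · refine lex_lt_iff.mpr ⟨n - 1 - i, fun j hj => ?_, ?_⟩
    · rw [shift_apply, trunc_of_lt (by omega), trunc_of_lt (by omega), hag j (by omega)]
    · rw [shift_apply, show i + (n - 1 - i) = n - 1 by omega,
        trunc_of_lt (i := n - 1 - i) (by omega)]
      have := hag (n - 1 - i) (by omega)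
      rw [show i + (n - 1 - i) = n - 1 by omega] at this
      rw [← this]
      exact trunc_last_lt (by omega) h0
  · have hle := hc.shift_le i
    have hne : shift i c ≠ c := fun h => hag fun j _ => congrFun h j
    obtain ⟨j, hj, hlt⟩ := lex_lt_iff.mp (lt_of_le_of_ne hle fun h => hne (toLex_inj.mp h))
    have hjn : j < n - i := by
      by_contra hjn
      exact hag fun k hk => hj k (by omega)
    refine lex_lt_iff.mpr ⟨j, fun k hk => ?_, ?_⟩
    · rw [shift_apply, trunc_of_lt (by omega), trunc_of_lt (by omega)]
      exact hj k hk
    · rw [shift_apply, trunc_of_lt (i := j) (by omega)]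
      refine lt_of_le_of_lt ?_ hlt
      rw [shift_apply]
      by_cases hlast : i + j < n - 1
      · rw [trunc_of_lt hlast]
      · rw [show i + j = n - 1 by omega]
        exact (trunc_last_lt (by omega) h0).le

/-- No tail of the word formed by the first `n` digits is the reflection of a prefix. -/
def IsGood (n : ℕ) (c : DigitSeq M) : Prop := ∀ i < n, ∃ j < n - i, c (i + j) ≠ reflect c j

/-- Admissibility gives only a weak inequality between a reflected tail and c; goodness forces it to
be decided strictly before the word ends. -/
lemma IsGood.exists_lt (hg : IsGood n c) (hc : Adm c) {i : ℕ} (hi : i < n) :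
    ∃ j < n - i, (∀ k < j, reflect (shift i c) k = c k) ∧ reflect (shift i c) j < c j := by
  obtain ⟨j, hj, hne⟩ := hg i hi
  have hne' : reflect (shift i c) ≠ c := by
    intro h
    apply hne
    have := congrFun (congrArg reflect h) j
    simpa using this
  obtain ⟨l, hl, hlt⟩ := lex_lt_iff.mp
    (lt_of_le_of_ne (hc.reflect_le i) fun h => hne' (toLex_inj.mp h))
  refine ⟨l, ?_, hl, hlt⟩
  by_contra hln
  apply hne
  have := congrArg Fin.rev (hl j (by omega))
  simpa [reflect] using this

lemma IsGood.last_ne_zero (hg : IsGood n c) (hc : Adm c) (hn : 1 ≤ n) : c (n - 1) ≠ 0 := by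
  obtain ⟨j, hj, -, hlt⟩ := hg.exists_lt hc (i := n - 1) (by omega)
  obtain rfl : j = 0 := by omega
  have h1 : ((reflect (shift (n - 1) c) 0 : Fin (M + 1)) : ℕ) < c 0 := hlt
  rw [reflect_val] at h1
  have := digit_le c 0
  intro h0
  simp [h0] at h1
  omega

/-- Lowering the last digit raises its reflection by one, which by goodness can at worst turn a
strict inequality into an equality; by periodicity and reflection the comparison then starts afresh
at an earlier position. The excluded case would give the constant sequence (M - 1)/2, which is
smaller than its reflection. -/
lemma IsGood.adm_trunc (hg : IsGood n c) (hc : Adm c) (hn : 1 ≤ n)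
    (hex : ¬ (n = 1 ∧ 2 * (c 0 : ℕ) = M + 1)) : Adm (trunc n c) := by
  have h0 := hg.last_ne_zero hc hn
  have key : ∀ m i, (∀ k < m, reflect (shift i (trunc n c)) k = trunc n c k) →
      ¬ trunc n c m < reflect (shift i (trunc n c)) m := by
    intro m
    induction m using Nat.strong_induction_on with
    | _ m ih =>
    intro i hag hlt
    rw [shift_mod_trunc] at hag hlt
    have hr : i % n < n := Nat.mod_lt _ hn
    generalize i % n = r at hag hlt hr
    obtain ⟨j, hj, hjag, hjlt⟩ := hg.exists_lt hc hr
    have hreach : ∀ k, k < n - 1 - r → k < j → trunc n c k = reflect (shift r (trunc n c)) k := by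
      intro k hk hkj
      rw [trunc_of_lt (by omega), ← hjag k hkj]
      simp only [reflect, shift_apply]
      rw [trunc_of_lt (i := r + k) (by omega)]
    by_cases hjl : r + j < n - 1
    · have h1 : reflect (shift r (trunc n c)) j < trunc n c j := by
        rw [trunc_of_lt (i := j) (by omega)]
        simp only [reflect, shift_apply] at hjlt ⊢
        rwa [trunc_of_lt hjl]
      rcases lt_trichotomy m j with h | h | h
      · exact hlt.ne (hreach m (by omega) h)
      · rw [h] at hlt; exact lt_asymm hlt h1
      · exact h1.ne (hag j h)
    · have hrj : r + j = n - 1 := by omega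
      have hmj : j ≤ m := by
        by_contra h
        exact hlt.ne (hreach m (by omega) (by omega))
      have hjl' : M - (c (n - 1) : ℕ) < c j := by
        have h1 : ((reflect (shift r c) j : Fin (M + 1)) : ℕ) < c j := hjlt
        rwa [reflect_val, shift_apply, hrj] at h1
      have hlast := trunc_last hn h0
      have hcl := digit_le c (n - 1)
      -- For r = 0 the lowered digit occurs on both sides, and the inequality fails only if 2 c (n -
      -- 1) = M + 1. For n > 1 this contradicts c 0 = M - c 0, which makes M even.
      have hle : M - (trunc n c (n - 1) : ℕ) ≤ trunc n c j := by
        rcases Nat.eq_zero_or_pos r with hr0 | hr0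
        · have hj' : j = n - 1 := by omega
          rw [hj'] at hjl' ⊢
          by_cases hodd : 2 * (c (n - 1) : ℕ) = M + 1
          · exfalso
            by_cases hn1 : n = 1
            · exact hex ⟨hn1, by rw [hn1] at hodd; exact hodd⟩
            · have h1 := congrArg Fin.val (hjag 0 (by omega))
              rw [reflect_val, hr0, shift_zero] at h1
              have := digit_le c 0
              omega
          · omega
        · rw [trunc_of_lt (i := j) (by omega)]
          omega
      have hval : ((reflect (shift r (trunc n c)) j : Fin (M + 1)) : ℕ)
          = M - (trunc n c (n - 1) : ℕ) := by
        rw [reflect_val, shift_apply, hrj]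
      rcases hmj.eq_or_lt with h | h
      · subst h
        have : (trunc n c j : ℕ) < (reflect (shift r (trunc n c)) j : Fin (M + 1)) := hlt
        omega
      -- A full period has been used up; reflecting both sides turns the rest into a violation for
      -- the shift n - r at the earlier position m - (n - r).
      · refine ih (m - (n - r)) (by omega) (n - r) (fun k hk => ?_) ?_
        · have h1 := hag (n - r + k) (by omega)
          have h2 := congrFun (shift_trunc (n := n) (c := c)) k
          simp only [reflect, shift_apply] at h1 h2 ⊢
          rw [show r + (n - r + k) = n + k by omega, h2] at h1
          rw [← h1]
          simp
        · have h2 := congrFun (shift_trunc (n := n) (c := c)) (m - (n - r))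
          simp only [reflect, shift_apply] at hlt h2 ⊢
          rw [show r + m = n + (m - (n - r)) by omega, h2] at hlt
          rw [show n - r + (m - (n - r)) = m by omega]
          simpa using Fin.rev_lt_rev.mpr hlt
  refine ⟨fun i => ?_, fun i => ?_⟩
  · rw [shift_mod_trunc]
    rcases Nat.eq_zero_or_pos (i % n) with h | h
    · rw [h, shift_zero]
    · exact (shift_trunc_lt hc h0 h (Nat.mod_lt _ hn)).le
  · by_contra hlt
    obtain ⟨m, hm, hlt⟩ := lex_lt_iff.mp (not_le.mp hlt)
    exact key m i (fun k hk => (hm k hk).symm) hlt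

/-- There is no admissible sequence strictly between `trunc n c` and `c` if the `n`-th tail of `c`
is its reflection. -/
lemma Adm.le_trunc {d : DigitSeq M} (hd : Adm d) (h : toLex d < toLex c) (hn : 1 ≤ n)
    (h0 : c (n - 1) ≠ 0) (hc : shift n c = reflect c) : toLex d ≤ toLex (trunc n c) := by
  by_contra hlt
  obtain ⟨m, hm, hlt⟩ := lex_lt_iff.mp (not_le.mp hlt)
  -- A first difference inside the word makes d exceed c or share the first n digits of c, which
  -- `Adm.not_agree` forbids; a later one makes the n-th tail of d exceed d.
  rcases lt_trichotomy m (n - 1) with hmn | hmn | hmn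
  · refine lt_asymm h (lex_lt_iff.mpr ⟨m, fun i hi => ?_, ?_⟩)
    · rw [← hm i hi, trunc_of_lt (by omega)]
    · rwa [trunc_of_lt hmn] at hlt
  · subst hmn
    have h1 := trunc_last hn h0
    have hlt : (trunc n c (n - 1) : ℕ) < d (n - 1) := hlt
    have hag : ∀ i < n - 1, d i = c i := fun i hi => by rw [← hm i hi, trunc_of_lt hi]
    rcases (show (c (n - 1) : ℕ) ≤ d (n - 1) by omega).eq_or_lt with h2 | h2
    · refine hd.not_agree h hc fun i hi => ?_
      rcases (show i ≤ n - 1 by omega).eq_or_lt with h3 | h3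
      · rw [h3]; exact Fin.ext h2.symm
      · exact hag i h3
    · exact lt_asymm h (lex_lt_iff.mpr ⟨n - 1, fun i hi => (hag i hi).symm, Fin.lt_def.mpr h2⟩)
  · have hper := fun k => congrFun (shift_trunc (n := n) (c := c)) k
    simp only [shift_apply] at hper
    refine absurd (hd.shift_le n) (not_le.mpr (lex_lt_iff.mpr ⟨m - n, fun i hi => ?_, ?_⟩))
    · rw [shift_apply, ← hm _ (by omega), ← hm _ (by omega), hper]
    · rw [shift_apply, ← hm _ (by omega), Nat.add_sub_cancel' (by omega : n ≤ m), ← hper,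
        Nat.add_sub_cancel' (by omega : n ≤ m)]
      exact hlt

/-- If no tail of `c` is the reflection of `c`, there are arbitrarily long good prefixes. -/
lemma Adm.exists_isGood (hc : Adm c) (hne : ∀ i, shift i c ≠ reflect c) (K : ℕ) :
    ∃ k, K ≤ k ∧ IsGood k c := by
  classical
  by_cases hK : IsGood (K + 1) c
  · exact ⟨K + 1, by omega, hK⟩
  have hex : ∃ i, i < K + 1 ∧ ∀ j < K + 1 - i, c (i + j) = reflect c j := by
    simpa [IsGood] using hK
  have hspec := Nat.find_spec hex
  have hmin := fun k (hk : k < Nat.find hex) => Nat.find_min hex hk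
  generalize Nat.find hex = i at hspec hmin
  obtain ⟨hiK, hag⟩ := hspec
  have hlt := lt_of_le_of_ne (hc.le_shift i) fun h => hne i (toLex_inj.mp h).symm
  obtain ⟨e, he, hlt⟩ := lex_lt_iff.mp hlt
  have heK : K + 1 - i ≤ e := by
    by_contra h
    exact hlt.ne (hag e (by omega)).symm
  -- Here i is the earliest position from which the word repeats the reflected prefix, and e is
  -- where this repetition breaks. A match starting before i contradicts minimality, one at i
  -- contradicts the choice of e, and one after i would make the tail of c at i' - i exceed c.
  refine ⟨i + e + 1, by omega, fun i' hi' => ?_⟩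
  by_contra hcon
  push Not at hcon
  rcases lt_trichotomy i' i with h | h | h
  · exact hmin i' h ⟨by omega, fun j hj => hcon j (by omega)⟩
  · subst h
    exact hlt.ne (hcon e (by omega)).symm
  · refine absurd (hc.shift_le (i' - i)) (not_le.mpr (lex_lt_iff.mpr
      ⟨i + e - i', fun j hj => ?_, ?_⟩))
    · have h1 := hcon j (by omega)
      have h2 := he (i' - i + j) (by omega)
      rw [shift_apply, show i + (i' - i + j) = i' + j by omega, h1] at h2
      simpa [reflect] using h2.symm
    · have h1 := hcon (i + e - i') (by omega)
      rw [show i' + (i + e - i') = i + e by omega] at h1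
      rw [shift_apply, h1] at hlt
      rw [shift_apply, show i' - i + (i + e - i') = e by omega]
      simpa [reflect] using hlt

/-- A match at i < n, combined with reflect c ≤ shift i c, gives shift (n - i) (reflect c) ≤ reflect
c. As the reverse inequality always holds, the match extends to shift i c = reflect c, against
minimality. -/
lemma Adm.isGood_of_minimal (hc : Adm c) (hn : shift n c = reflect c)
    (hmin : ∀ i < n, shift i c ≠ reflect c) : IsGood n c := by
  intro i hi
  by_contra hcon
  push Not at hcon
  have h1 : toLex (reflect c) ≤ toLex (shift (n - i) (reflect c)) := by
    rw [← reflect_shift]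
    exact reflect_le_reflect (hc.shift_le (n - i))
  have h2 : toLex (shift (n - i) (reflect c)) ≤ toLex (shift (n - i) (shift i c)) :=
    (lex_le_shift_iff fun j hj => (hcon j hj).symm).mp (hc.le_shift i)
  rw [shift_shift, show i + (n - i) = n by omega, hn] at h2
  have h3 := toLex_inj.mp (le_antisymm h1 h2)
  refine hmin i hi (eq_of_shift_eq (n := n - i) (fun j hj => hcon j hj) ?_)
  rw [shift_shift, show i + (n - i) = n by omega, hn, ← h3]

end trunc

/-! ### Admissible expansions of 1 and the sets U and V -/

/-- All tails of `c` have values in the open interval `(0, M / (q - 1))`. -/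
def Inner (q : ℝ) (c : DigitSeq M) : Prop :=
  ∀ i, 0 < val q (shift i c) ∧ val q (shift i c) < (M : ℝ) / (q - 1)

lemma one_lt_top (hq : 1 < q) (hqM : q < M + 1) : 1 < (M : ℝ) / (q - 1) := by
  rw [lt_div_iff₀ (by linarith)]
  linarith

lemma mul_top (hq : 1 < q) : q * ((M : ℝ) / (q - 1)) = (M : ℝ) / (q - 1) + M := by
  have : q - 1 ≠ 0 := by linarith
  field_simp
  ring

lemma exists_inner (hq : 1 < q) (hqM : q < M + 1) {y : ℝ} (hy : 0 < y)
    (hy' : y < (M : ℝ) / (q - 1)) : ∃ c : DigitSeq M, val q c = y ∧ Inner q c := by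
  -- The largest digit strictly below q x; this choice keeps the orbit inside the open interval.
  let dg : ℝ → Fin (M + 1) := fun x => ⟨min M (⌈q * x⌉₊ - 1), by omega⟩
  let t : ℕ → ℝ := fun i => Nat.rec y (fun _ x => q * x - (dg x : ℕ)) i
  have ht : ∀ i, t (i + 1) = q * t i - (dg (t i) : ℕ) := fun i => rfl
  have htop := one_lt_top hq hqM
  have hI : ∀ i, 0 < t i ∧ t i < (M : ℝ) / (q - 1) := by
    intro i
    induction i with
    | zero => exact ⟨hy, hy'⟩
    | succ i ih =>
      rw [ht]
      have hpos : 0 < q * t i := mul_pos (by linarith) ih.1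
      have hc : 1 ≤ ⌈q * t i⌉₊ := Nat.ceil_pos.mpr hpos
      have h1 : q * t i ≤ ⌈q * t i⌉₊ := Nat.le_ceil _
      have h2 : (⌈q * t i⌉₊ : ℝ) < q * t i + 1 := Nat.ceil_lt_add_one hpos.le
      have h3 : q * t i < (M : ℝ) / (q - 1) + M := by
        rw [← mul_top hq]
        exact mul_lt_mul_of_pos_left ih.2 (by linarith)
      change 0 < q * t i - ((min M (⌈q * t i⌉₊ - 1) : ℕ) : ℝ) ∧
        q * t i - ((min M (⌈q * t i⌉₊ - 1) : ℕ) : ℝ) < _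
      rcases le_total M (⌈q * t i⌉₊ - 1) with h | h
      · rw [min_eq_left h]
        have h4 : (M : ℝ) + 1 ≤ ⌈q * t i⌉₊ := by
          have : M + 1 ≤ ⌈q * t i⌉₊ := by omega
          exact_mod_cast this
        exact ⟨by linarith, by linarith⟩
      · rw [min_eq_right h, Nat.cast_sub hc]
        exact ⟨by push_cast; linarith, by push_cast; linarith⟩
  have hval := val_eq_of_orbit (c := fun i => dg (t i)) hq ht (K := (M : ℝ) / (q - 1))
    (fun i => by rw [abs_of_pos (hI i).1]; exact (hI i).2.le)
  refine ⟨fun i => dg (t i), ?_, fun i => ?_⟩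
  · have := hval 0
    rwa [shift_zero] at this
  · rw [hval]; exact hI i

lemma val_shift_reflect (hq : 1 < q) (c : DigitSeq M) (i : ℕ) :
    val q (shift i (reflect c)) = (M : ℝ) / (q - 1) - val q (shift i c) := by
  rw [← reflect_shift, val_reflect hq]

lemma exists_ne_zero {c : DigitSeq M} (h : 0 < val q c) : ∃ i, c i ≠ 0 := by
  by_contra hcon
  push Not at hcon
  simp [val, hcon] at h

lemma isInfinite_of_val_pos {c : DigitSeq M} {n : ℕ}
    (h : ∀ i, 0 < val q (shift (n + i) c)) : IsInfinite c := by
  refine Or.inl (Set.infinite_of_forall_exists_gt fun a => ?_)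
  obtain ⟨k, hk⟩ := exists_ne_zero (h (a + 1))
  exact ⟨_, hk, by omega⟩

lemma isDoublyInfinite_of_inner_shift (hq : 1 < q) {c : DigitSeq M} {n : ℕ}
    (h : Inner q (shift n c)) : IsDoublyInfinite c := by
  refine ⟨isInfinite_of_val_pos (q := q) (n := n) fun i => ?_,
    isInfinite_of_val_pos (q := q) (n := n) fun i => ?_⟩
  · simpa using (h i).1
  · have := (h i).2
    rw [shift_shift] at this
    rw [val_shift_reflect hq]
    linarith

lemma IsInfinite.val_pos (hq : 1 < q) {c : DigitSeq M} (h : IsInfinite c) (hc : 0 < val q c)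
    (i : ℕ) : 0 < val q (shift i c) := by
  rcases h with h | h
  · obtain ⟨k, hk, hik⟩ := h.exists_gt i
    refine Univoque.val_pos hq ⟨k - i, ?_⟩
    rw [shift_apply, Nat.add_sub_cancel' hik.le]
    exact hk
  · simp [val, h] at hc

lemma IsDoublyInfinite.inner (hq : 1 < q) {c : DigitSeq M} (h : IsDoublyInfinite c)
    (h0 : 0 < val q c) (h1 : val q c < (M : ℝ) / (q - 1)) : Inner q c := by
  intro i
  refine ⟨h.1.val_pos hq h0 i, ?_⟩
  have := h.2.val_pos hq (by rw [val_reflect hq]; linarith) i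
  rw [val_shift_reflect hq] at this
  linarith

/-- `c` is the admissible expansion of `1` in base `q`. -/
structure IsAlpha (q : ℝ) (c : DigitSeq M) : Prop where
  val_eq : val q c = 1
  adm : Adm c
  tail_le : ∀ i, val q (shift i c) ≤ 1
  le_tail : ∀ i, (M : ℝ) / (q - 1) - 1 ≤ val q (shift i c)
  inner : Inner q c
  unique : ∀ d : DigitSeq M, Inner q d → val q d = 1 → d = c

lemma Adm.isAlpha (hq : 1 < q) (hqM : q < M + 1) {c : DigitSeq M} (hc : Adm c)
    (h1 : val q c = 1) : IsAlpha q c := by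
  have htop := one_lt_top hq hqM
  have htail : ∀ i, val q (shift i c) ≤ 1 := fun i =>
    val_le_one hq h1.le (Set.range fun i => shift i c)
      (by rintro _ ⟨i, rfl⟩ j; exact ⟨i + j, by simp⟩)
      (by rintro _ ⟨i, rfl⟩; exact hc.shift_le i) _ ⟨i, rfl⟩
  have htail' : ∀ i, (M : ℝ) / (q - 1) - 1 ≤ val q (shift i c) := fun i => by
    have := val_le_one hq h1.le (Set.range fun i => reflect (shift i c))
      (by rintro _ ⟨i, rfl⟩ j; exact ⟨i + j, by simp [reflect_shift]⟩)
      (by rintro _ ⟨i, rfl⟩; exact hc.reflect_le i) _ ⟨i, rfl⟩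
    rw [val_reflect hq] at this
    linarith
  refine ⟨h1, hc, htail, htail', fun i => ⟨by linarith [htail' i], by linarith [htail i]⟩, ?_⟩
  intro d hd hd1
  -- At the first difference, changing the digit of c by at least one moves its next remainder,
  -- which lies in [M/(q-1) - 1, 1], out of (0, M/(q-1)).
  by_contra hne
  obtain ⟨j, hj, hdj⟩ := exists_first_diff hne
  have e1 := pow_mul_val_sub hq j hj
  rw [h1, hd1, sub_self, mul_zero] at e1
  have e2 := val_shift_succ hq c j
  have e3 := val_shift_succ hq d j
  have e4 : val q (shift j d) = val q (shift j c) := by linarith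
  rw [e4] at e3
  have := hd (j + 1)
  rcases lt_or_gt_of_ne hdj with h | h
  · have := one_le_sub_of_lt h
    linarith [htail' (j + 1)]
  · have := one_le_sub_of_lt h
    linarith [htail (j + 1)]

lemma IsAlpha.mem_setV (hq : 1 < q) (hqM : q < M + 1) {c : DigitSeq M} (hc : IsAlpha q c) :
    q ∈ setV M := by
  refine ⟨hq, c, ⟨(isExpansion_iff hq).mpr hc.val_eq,
    isDoublyInfinite_of_inner_shift (n := 0) hq (by simpa using hc.inner)⟩, ?_⟩
  rintro d ⟨hd, hd'⟩
  have hd := (isExpansion_iff hq).mp hd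
  exact hc.unique d (hd'.inner hq (by rw [hd]; norm_num) (by rw [hd]; exact one_lt_top hq hqM)) hd

/-- A second possible digit at time i can be continued by `exists_inner`; uniqueness therefore
leaves only one choice at each time. -/
lemma exists_splice (hq : 1 < q) (hqM : q < M + 1) (c : DigitSeq M) (i : ℕ) {k : Fin (M + 1)}
    (hk : k ≠ c i) (h0 : 0 < q * val q (shift i c) - (k : ℕ))
    (h1 : q * val q (shift i c) - (k : ℕ) < (M : ℝ) / (q - 1)) :
    ∃ d : DigitSeq M, d ≠ c ∧ val q d = val q c ∧ IsDoublyInfinite d := by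
  obtain ⟨e, he, he'⟩ := exists_inner hq hqM h0 h1
  let d : DigitSeq M := fun j => if j < i then c j else if j = i then k else e (j - (i + 1))
  have hdi : d i = k := by simp [d]
  have hde : shift (i + 1) d = e := by
    funext j
    have h1 : ¬ i + 1 + j < i := by omega
    have h2 : ¬ i + 1 + j = i := by omega
    simp [d, h1, h2]
  refine ⟨d, fun h => hk (by rw [← hdi, h]), ?_,
    isDoublyInfinite_of_inner_shift (n := i + 1) hq (by rwa [hde])⟩
  refine val_eq_of_agree hq i (fun j hj => by simp [d, hj]) ?_
  have := val_shift_succ hq d i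
  rw [hde, he, hdi] at this
  have : q * val q (shift i c) = q * val q (shift i d) := by linarith
  exact (mul_left_cancel₀ (by linarith) this).symm

lemma exists_isAlpha_of_unique (hq : 1 < q) (hqM : q < M + 1) {c : DigitSeq M}
    (h1 : val q c = 1) (hc : IsDoublyInfinite c)
    (huniq : ∀ d : DigitSeq M, val q d = 1 → IsDoublyInfinite d → d = c) : IsAlpha q c := by
  have htop := one_lt_top hq hqM
  have hin : Inner q c := hc.inner hq (by rw [h1]; norm_num) (by rwa [h1])
  have hno : ∀ i (k : Fin (M + 1)), k ≠ c i → 0 < q * val q (shift i c) - (k : ℕ) →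
      q * val q (shift i c) - (k : ℕ) < (M : ℝ) / (q - 1) → False := by
    intro i k hk h0 h2
    obtain ⟨d, hd, hdv, hdi⟩ := exists_splice hq hqM c i hk h0 h2
    exact hd (huniq d (hdv.trans h1) hdi)
  -- If a remainder exceeded 1, the preceding digit could be raised by one. If that digit is already
  -- M, then q < M + 1 bounds the remainder by q - M < 1.
  have hA : ∀ i, val q (shift i c) ≤ 1 := by
    intro i
    induction i with
    | zero => simp [h1]
    | succ i ih =>
      by_contra hgt
      have hs := val_shift_succ hq c i
      have hq1 : q * val q (shift i c) ≤ q * 1 := mul_le_mul_of_nonneg_left ih (by linarith)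
      rcases (digit_le c i).eq_or_lt with h | h
      · rw [h] at hs
        linarith
      · refine hno i ⟨c i + 1, by omega⟩ (fun h => ?_) ?_ ?_
        · have := congrArg Fin.val h; simp at this
        · push_cast; linarith
        · push_cast; linarith [(hin (i + 1)).2]
  have hB : ∀ i, (M : ℝ) / (q - 1) - 1 ≤ val q (shift (i + 1) c) := by
    intro i
    by_contra hlt
    have hs := val_shift_succ hq c i
    rcases Nat.eq_zero_or_pos (c i : ℕ) with h | h
    · rw [h] at hs
      -- After a zero digit the previous remainder is too small as well. Going back, either a
      -- positive digit turns up, which can be lowered, or the start is reached, where q = val q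
      -- (shift 1 c) ≤ 1.
      induction i with
      | zero =>
        rw [shift_zero, h1] at hs
        have := hA 1
        norm_num at hs
        linarith
      | succ i ih =>
        by_cases hi : (M : ℝ) / (q - 1) - 1 ≤ val q (shift (i + 1) c)
        · have h2 := mul_le_mul_of_nonneg_left hi (by linarith : 0 ≤ q)
          have h3 := mul_top (M := M) hq
          rw [mul_sub, h3] at h2
          norm_num at hs
          linarith
        · have h2 : val q (shift (i + 1) c) ≤ q * val q (shift (i + 1) c) :=
            le_mul_of_one_le_left (hin _).1.le hq.le
          rcases Nat.eq_zero_or_pos (c i : ℕ) with h' | h'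
          · exact ih hi (by rw [val_shift_succ hq, h']) h'
          · refine hno i ⟨c i - 1, by omega⟩ (fun h => ?_) ?_ ?_
            · have := congrArg Fin.val h; simp at this; omega
            all_goals
              have := val_shift_succ hq c i
              have h3 := (hin (i + 1)).1
              rw [Nat.cast_sub h']
              push_cast
              linarith
    · refine hno i ⟨c i - 1, by omega⟩ (fun h => ?_) ?_ ?_
      · have := congrArg Fin.val h; simp at this; omega
      all_goals
        have h3 := (hin (i + 1)).1
        rw [Nat.cast_sub h]
        push_cast
        linarith
  refine Adm.isAlpha hq hqM (Adm.of_pos (fun i => ?_) fun i hi => ?_) h1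
  · by_contra hlt
    have := val_lt_val hq (not_le.mp hlt) (fun j _ => hA j) fun j => by
      rw [shift_shift]; exact (hin _).1
    linarith [hA i]
  · by_contra hlt
    have h2 := val_lt_val hq (not_le.mp hlt) (fun j _ => hA j) fun j => by
      rw [val_shift_reflect hq, shift_shift]; linarith [(hin (i + j)).2]
    obtain ⟨k, rfl⟩ : ∃ k, i = k + 1 := ⟨i - 1, by omega⟩
    rw [val_reflect hq] at h2
    linarith [hB k]

lemma exists_isAlpha_of_mem_setV (hqM : q < M + 1) (h : q ∈ setV M) :
    ∃ c : DigitSeq M, IsAlpha q c := by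
  obtain ⟨hq, c, ⟨hc, hc'⟩, hu⟩ := h
  exact ⟨c, exists_isAlpha_of_unique hq hqM ((isExpansion_iff hq).mp hc) hc'
    fun d hd hd' => hu d ⟨(isExpansion_iff hq).mpr hd, hd'⟩⟩

lemma exists_isAlpha_of_mem_setU (hqM : q < M + 1) (h : q ∈ setU M) :
    ∃ c : DigitSeq M, IsAlpha q c ∧ ∀ d : DigitSeq M, val q d = 1 → d = c := by
  obtain ⟨hq, c, hc, hu⟩ := h
  obtain ⟨d, hd, hd'⟩ := exists_inner hq hqM one_pos (one_lt_top hq hqM)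
  have hu' : ∀ d : DigitSeq M, val q d = 1 → d = c := fun d hd =>
    hu d ((isExpansion_iff hq).mpr hd)
  obtain rfl := hu' d hd
  exact ⟨d, exists_isAlpha_of_unique hq hqM hd
    (isDoublyInfinite_of_inner_shift (n := 0) hq (by simpa using hd')) fun e he _ => hu' e he, hu'⟩

lemma IsAlpha.lt_of_lt {p : ℝ} (hp : 1 < p) (hpq : p < q) {c d : DigitSeq M}
    (hd : IsAlpha p d) (hc : IsAlpha q c) : toLex d < toLex c := by
  have hq := hp.trans hpq
  have hne : ∀ i, ∃ k, shift i d k ≠ 0 := fun i => exists_ne_zero (hd.inner i).1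
  have h1 : val q d < 1 := by
    rw [← hd.val_eq]
    exact val_strictAnti hp hpq (by simpa using hne 0)
  by_contra hle
  rcases (not_lt.mp hle).lt_or_eq with h | h
  · have := val_lt_val hq h (fun i _ => hc.tail_le i) fun i => val_pos hq (hne i)
    linarith [hc.val_eq]
  · rw [← toLex_inj.mp h, hc.val_eq] at h1
    exact lt_irrefl _ h1

/-- A base whose admissible expansion of `1` has a tail equal to its own reflection is not
univoque. -/
lemma IsAlpha.exists_other (hM : 1 ≤ M) (hq : 1 < q) {c : DigitSeq M}
    (hc : IsAlpha q c) {n : ℕ} (hn : 1 ≤ n) (h : shift n c = reflect c) :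
    ∃ d : DigitSeq M, d ≠ c ∧ val q d = 1 := by
  -- A zero here would make the tail at n - 1 equal to 0 followed by reflect c; since this is at
  -- least reflect c, the sequence c would be constantly M.
  have h0 : c (n - 1) ≠ 0 := by
    intro h0
    have h1 := hc.adm.le_shift (n - 1)
    have e0 : shift (n - 1) c 0 = 0 := by simpa using h0
    have e1 : shift 1 (shift (n - 1) c) = reflect c := by
      rw [shift_shift, show n - 1 + 1 = n by omega, h]
    have e2 : reflect c 0 = 0 := by
      have h2 := digit_le_of_lex_le h1
      rw [e0] at h2
      exact le_antisymm h2 (Fin.zero_le _)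
    have h3 := (lex_le_shift_iff (n := 1) (fun i hi => by
      obtain rfl : i = 0 := by omega
      rw [e2, e0])).mp h1
    rw [e1, ← reflect_shift] at h3
    have h4 := reflect_le_reflect h3
    rw [reflect_reflect, reflect_reflect] at h4
    have h5 : shift 1 c = c := toLex_inj.mp (le_antisymm (hc.adm.shift_le 1) h4)
    have h6 : ∀ i, c i = c 0 := by
      intro i
      induction i with
      | zero => rfl
      | succ i ih =>
        rw [← ih]
        have := congrFun h5 i
        rwa [shift_apply, add_comm 1 i] at this
    have h7 := congrArg Fin.val e2
    rw [reflect_val, ← h6 (n - 1), h0] at h7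
    simp at h7
    omega
  have hpos : 1 ≤ (c (n - 1) : ℕ) := Nat.one_le_iff_ne_zero.mpr fun h => h0 (Fin.ext h)
  let k : Fin (M + 1) := ⟨c (n - 1) - 1, by omega⟩
  -- Lowering digit n - 1 by one adds 1 to the remainder M/(q-1) - 1, so the new remainder is
  -- M/(q-1), which is expanded by digits M only.
  let d : DigitSeq M := fun j => if j < n - 1 then c j else if j = n - 1 then k else Fin.last M
  have hdn : d (n - 1) = k := by simp [d]
  have hds : val q (shift n d) = (M : ℝ) / (q - 1) := by
    rw [val]
    refine Eq.trans (tsum_congr fun i => ?_) (hasSum_geometric_digits hq M).tsum_eq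
    have h1 : ¬ n + i < n - 1 := by omega
    have h2 : ¬ n + i = n - 1 := by omega
    simp [d, h1, h2]
  have hcs : val q (shift n c) = (M : ℝ) / (q - 1) - 1 := by
    rw [h, val_reflect hq, hc.val_eq]
  refine ⟨d, fun h => ?_, ?_⟩
  · have := congrArg Fin.val (congrFun h (n - 1))
    rw [hdn] at this
    simp [k] at this
    omega
  · rw [← hc.val_eq]
    refine val_eq_of_agree hq (n - 1) (fun j hj => by simp [d, hj]) ?_
    have h1 := val_shift_succ hq d (n - 1)
    have h2 := val_shift_succ hq c (n - 1)
    rw [show n - 1 + 1 = n by omega] at h1 h2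
    rw [hds, hdn] at h1
    rw [hcs] at h2
    have : ((k : ℕ) : ℝ) = (c (n - 1) : ℕ) - 1 := by simp [k, Nat.cast_sub hpos]
    have : q * val q (shift (n - 1) d) = q * val q (shift (n - 1) c) := by linarith
    exact mul_left_cancel₀ (by linarith) this

/-! ### The closure of U -/

/-- An admissible sequence that starts with a long prefix of an admissible sequence with a tail
equal to its reflection coincides with it. -/
lemma Adm.eq_of_agree {c d : DigitSeq M} (hd : Adm d) {n : ℕ} (hn : 1 ≤ n)
    (h : shift n c = reflect c) (hag : ∀ i < 2 * n, d i = c i) : d = c := by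
  rcases lt_trichotomy (toLex d) (toLex c) with hlt | heq | hlt
  · exact absurd (fun i hi => hag i (by omega)) (hd.not_agree hlt h)
  · exact toLex_inj.mp heq
  · exfalso
    obtain ⟨j, hj, hlt⟩ := lex_lt_iff.mp hlt
    have hjn : 2 * n ≤ j := by
      by_contra hjn
      exact hlt.ne (hag j (by omega)).symm
    -- Reflecting twice shows that c has period 2n, so a larger d would have its tail at 2n larger
    -- than itself.
    have hper : ∀ k, c (2 * n + k) = c k := by
      intro k
      have h1 := congrFun h (n + k)
      have h2 := congrFun h k
      simp only [shift_apply, reflect] at h1 h2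
      rw [show 2 * n + k = n + (n + k) by ring, h1, h2, Fin.rev_rev]
    refine absurd (hd.shift_le (2 * n)) (not_le.mpr (lex_lt_iff.mpr
      ⟨j - 2 * n, fun i hi => ?_, ?_⟩))
    · rw [shift_apply, ← hj _ (by omega), ← hj _ (by omega), hper]
    · rw [shift_apply, Nat.add_sub_cancel' hjn, ← hj _ (by omega), ← hper,
        Nat.add_sub_cancel' hjn]
      exact hlt

/-- A violated lexicographic inequality is visible on finitely many digits, so such inequalities
survive limits of sequences. -/
lemma lex_le_of_agree {c : DigitSeq M} {F G : DigitSeq M → DigitSeq M}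
    (h : ∀ m, ∃ e : DigitSeq M, toLex (F e) ≤ toLex (G e) ∧ (∀ i < m, F e i = F c i) ∧
      ∀ i < m, G e i = G c i) : toLex (F c) ≤ toLex (G c) := by
  by_contra hlt
  obtain ⟨j, hj, hlt⟩ := lex_lt_iff.mp (not_le.mp hlt)
  obtain ⟨e, he, h1, h2⟩ := h (j + 1)
  refine absurd he (not_le.mpr (lex_lt_iff.mpr ⟨j, fun i hi => ?_, ?_⟩))
  · rw [h1 i (by omega), h2 i (by omega), hj i hi]
  · rw [h1 j (by omega), h2 j (by omega)]
    exact hlt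

lemma Adm.of_agree {c : DigitSeq M}
    (h : ∀ m, ∃ e : DigitSeq M, Adm e ∧ ∀ i < m, e i = c i) : Adm c := by
  refine ⟨fun i => lex_le_of_agree (F := shift i) (G := id) fun m => ?_, fun i =>
    lex_le_of_agree (F := fun e => reflect (shift i e)) (G := id) fun m => ?_⟩
  · obtain ⟨e, he, hag⟩ := h (i + m)
    exact ⟨e, he.shift_le i, fun j hj => hag _ (by omega), fun j hj => hag _ (by omega)⟩
  · obtain ⟨e, he, hag⟩ := h (i + m)
    exact ⟨e, he.reflect_le i, fun j hj => congrArg Fin.rev (hag _ (by omega)),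
      fun j hj => hag _ (by omega)⟩

lemma exists_isAlpha_of_mem_closure (hM : 1 ≤ M) (hq : 1 < q) (hqM : q < M + 1)
    (h : q ∈ closure (setU M)) :
    ∃ c : DigitSeq M, IsAlpha q c ∧ ∀ n, shift n c ≠ reflect c := by
  obtain ⟨x, hxU, hx⟩ := mem_closure_iff_seq_limit.mp h
  have hev : ∀ᶠ n in Filter.atTop, x n ∈ Set.Ioo ((1 + q) / 2) ((M : ℝ) + 1) :=
    hx (Ioo_mem_nhds (by linarith) hqM)
  obtain ⟨N, hN⟩ := Filter.eventually_atTop.mp hev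
  have hc : ∀ n, ∃ c : DigitSeq M, IsAlpha (x (n + N)) c ∧
      ∀ d : DigitSeq M, val (x (n + N)) d = 1 → d = c := fun n =>
    exists_isAlpha_of_mem_setU (hN _ (by omega)).2 (hxU _)
  choose c hc hcu using hc
  -- The space of digit sequences is compact; a limit of the expansions in bases of U tending to q
  -- is the candidate for α(q).
  obtain ⟨a, φ, hφ, ha⟩ := CompactSpace.tendsto_subseq c
  have hag1 : ∀ i, ∀ᶠ j in Filter.atTop, c (φ j) i = a i := by
    intro i
    have := tendsto_pi_nhds.mp ha i
    rw [nhds_discrete, Filter.tendsto_pure] at this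
    exact this
  have hag : ∀ m, ∀ᶠ j in Filter.atTop, ∀ i < m, c (φ j) i = a i := by
    intro m
    have := (Finset.eventually_all (Finset.range m)).mpr fun i _ => hag1 i
    filter_upwards [this] with j hj i hi using hj i (Finset.mem_range.mpr hi)
  have hadm : Adm a := Adm.of_agree fun m => by
    obtain ⟨j, hj⟩ := (hag m).exists
    exact ⟨c (φ j), (hc _).adm, hj⟩
  have hx' : Filter.Tendsto (fun j => x (φ j + N)) Filter.atTop (nhds q) :=
    hx.comp ((Filter.tendsto_add_atTop_nat N).comp hφ.tendsto_atTop)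
  have hρ : 1 < (1 + q) / 2 := by linarith
  have hval : Filter.Tendsto (fun j => val (x (φ j + N)) (c (φ j))) Filter.atTop
      (nhds (val q a)) := by
    refine tendsto_tsum_of_dominated_convergence
      (bound := fun i => (M : ℝ) / ((1 + q) / 2) ^ (i + 1))
      (hasSum_geometric_digits hρ M).summable (fun i => ?_) (Filter.Eventually.of_forall
      fun j i => ?_)
    · refine Filter.Tendsto.div ?_ (hx'.pow _) (by positivity)
      refine tendsto_const_nhds.congr' ?_
      filter_upwards [hag1 i] with j hj
      rw [hj]
    · have h1 := (hN (φ j + N) (by omega)).1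
      have h2 : 0 < x (φ j + N) := by linarith
      rw [Real.norm_of_nonneg (by positivity)]
      have : ((c (φ j) i : ℕ) : ℝ) ≤ M := by exact_mod_cast digit_le _ i
      gcongr
  have h1 : val q a = 1 := by
    refine tendsto_nhds_unique hval ?_
    simp only [(hc _).val_eq]
    exact tendsto_const_nhds
  have hα := hadm.isAlpha hq hqM h1
  -- If a tail of a were its reflection, nearby expansions would coincide with a by
  -- `Adm.eq_of_agree`, and 1 would have a second expansion in a base of U.
  have hpos : ∀ n, 1 ≤ n → shift n a ≠ reflect a := by
    intro n hn hna
    obtain ⟨j, hj⟩ := (hag (2 * n)).exists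
    have hj1 : 1 < x (φ j + N) := hρ.trans (hN (φ j + N) (by omega)).1
    have heq := (hc (φ j)).adm.eq_of_agree hn hna hj
    have hca := hc (φ j)
    have hcua := hcu (φ j)
    rw [heq] at hca hcua
    obtain ⟨d, hd, hd1⟩ := hca.exists_other hM hj1 hn hna
    exact hd (hcua d hd1)
  refine ⟨a, hα, fun n hna => ?_⟩
  rcases Nat.eq_zero_or_pos n with rfl | hn
  · rw [shift_zero] at hna
    refine hpos 1 le_rfl ?_
    rw [← hna]
    have h2 := hadm.le_shift 1
    rw [← hna] at h2
    exact toLex_inj.mp (le_antisymm (hadm.shift_le 1) h2)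
  · exact hpos n hn hna

/-! ### The word common to the two bases -/

/-- The orbit of `1` under the maps `x ↦ q x - w i`. -/
noncomputable def orbit (q : ℝ) (w : ℕ → ℕ) : ℕ → ℝ
  | 0 => 1
  | i + 1 => q * orbit q w i - w i

/-- In base `q` the orbit of `1` along the word `w 0 ⋯ w (n - 1)` avoids the points `1` and
`M / (q - 1) - 1` and what lies outside of them, before the last digit is used. -/
structure IsWordBase (M n : ℕ) (w : ℕ → ℕ) (q : ℝ) : Prop where
  one_lt : 1 < q
  lt_succ : q < M + 1
  top_lt : (M : ℝ) / (q - 1) < 2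
  pos : 1 ≤ n
  digit_le : ∀ i, w i ≤ M
  last_pos : 1 ≤ w (n - 1)
  lt_orbit : ∀ i, 1 ≤ i → i < n → (M : ℝ) / (q - 1) - 1 < orbit q w i
  orbit_lt : ∀ i, 1 ≤ i → i < n → orbit q w i < 1

lemma IsAlpha.shift_eq {c : DigitSeq M} (hc : IsAlpha q c) {i : ℕ}
    (h : val q (shift i c) = 1) : shift i c = c :=
  hc.unique _ (fun j => by rw [shift_shift]; exact hc.inner _) h

lemma IsAlpha.shift_eq_reflect (hq : 1 < q) {c : DigitSeq M} (hc : IsAlpha q c) {i : ℕ}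
    (h : val q (shift i c) = (M : ℝ) / (q - 1) - 1) : shift i c = reflect c := by
  have h1 : reflect (shift i c) = c := by
    refine hc.unique _ (fun j => ?_) (by rw [val_reflect hq, h]; ring)
    rw [val_shift_reflect hq, shift_shift]
    have := hc.inner (i + j)
    exact ⟨by linarith, by linarith⟩
  rw [← reflect_reflect (shift i c), h1]

lemma orbit_eq_val (hq : 1 < q) {c : DigitSeq M} (hc : val q c = 1) {w : ℕ → ℕ} {n : ℕ}
    (hw : ∀ i < n, w i = c i) : ∀ i ≤ n, orbit q w i = val q (shift i c) := by
  intro i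
  induction i with
  | zero => simp [orbit, hc]
  | succ i ih =>
    intro hi
    rw [orbit, ih (by omega), val_shift_succ hq, hw i (by omega)]

/-- There is no admissible sequence between the admissible expansions of `1` in two bases without
elements of `V` between them. -/
lemma no_adm_between {q₀ q₁ : ℝ} (h0 : 1 < q₀) (h01 : q₀ < q₁) (h1 : q₁ < M + 1)
    (hV : ∀ p ∈ setV M, q₀ < p → q₁ ≤ p) {α₀ α₁ c : DigitSeq M} (hα₀ : IsAlpha q₀ α₀)
    (hα₁ : IsAlpha q₁ α₁) (hc : Adm c) (hc0 : toLex α₀ < toLex c) (hc1 : toLex c < toLex α₁) :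
    False := by
  have hone : 1 < q₁ := h0.trans h01
  have hpos : ∀ i, ∃ k, shift i c k ≠ 0 := by
    intro i
    by_contra hcon
    push Not at hcon
    have h2 := hc.le_shift i
    have h3 : toLex (shift i c) ≤ toLex (reflect α₁) := by
      by_contra hlt
      obtain ⟨j, -, hlt⟩ := lex_lt_iff.mp (not_le.mp hlt)
      rw [hcon] at hlt
      exact absurd hlt (by simp)
    exact absurd (h2.trans h3) (not_le.mpr (reflect_lt_reflect hc1))
  have hlow : 1 < val q₀ c := by
    rw [← hα₀.val_eq]
    exact val_lt_val h0 hc0 (fun i _ => hα₀.tail_le i) fun i => val_pos h0 (hpos i)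
  have htail : ∀ i, val q₁ (shift i c) ≤ 1 := fun i =>
    val_le_one hone hα₁.val_eq.le (Set.range fun i => shift i c)
      (by rintro _ ⟨i, rfl⟩ j; exact ⟨i + j, by simp⟩)
      (by rintro _ ⟨i, rfl⟩; exact (hc.shift_le i).trans hc1.le) _ ⟨i, rfl⟩
  have hhigh : val q₁ c < 1 := by
    rw [← hα₁.val_eq]
    exact val_lt_val hone hc1 (fun i _ => htail i) fun i => (hα₁.inner i).1
  -- The value of c exceeds 1 in base q₀ and is below 1 in base q₁, so c expands 1 in a base p of V
  -- in between.
  obtain ⟨p, hp, hpc⟩ := intermediate_value_Icc' h01.le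
    ((continuousOn_val h0 c).mono Set.Icc_subset_Ici_self) ⟨hhigh.le, hlow.le⟩
  have hpc : val p c = 1 := hpc
  have hp0 : q₀ < p := lt_of_le_of_ne hp.1 fun h => by rw [← h] at hpc; linarith
  have hp1 : p < q₁ := lt_of_le_of_ne hp.2 fun h => by rw [h] at hpc; linarith
  have hpV := (hc.isAlpha (h0.trans hp0) (hp1.trans h1) hpc).mem_setV (h0.trans hp0) (hp1.trans h1)
  exact absurd (hV p hpV hp0) (not_le.mpr hp1)

/-- The admissible expansions of `1` in the base `q₁` and in the preceding base `q₀` are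
determined by a common word. -/
lemma exists_word {q₀ q₁ : ℝ} (h0 : 1 < q₀) (h01 : q₀ < q₁) (h1 : q₁ < M + 1)
    (hV : ∀ p ∈ setV M, q₀ < p → q₁ ≤ p) {α₀ α₁ : DigitSeq M} (hα₀ : IsAlpha q₀ α₀)
    (hα₁ : IsAlpha q₁ α₁) :
    ∃ n, 1 ≤ n ∧ α₁ (n - 1) ≠ 0 ∧ α₀ = trunc n α₁ ∧ shift n α₁ = reflect α₁ ∧
      ∀ i < n, shift i α₁ ≠ reflect α₁ := by
  classical
  have hlt := hα₀.lt_of_lt h0 h01 hα₁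
  by_cases hex : ∃ n, shift n α₁ = reflect α₁
  · have hn := Nat.find_spec hex
    have hmin := fun i (hi : i < Nat.find hex) => Nat.find_min hex hi
    generalize Nat.find hex = n at hn hmin
    have hn1 : 1 ≤ n := by
      rcases Nat.eq_zero_or_pos n with rfl | h
      · exact absurd (by rwa [shift_zero] at hn) (hα₀.adm.ne_of_lt hlt)
      · exact h
    have hgood := hα₁.adm.isGood_of_minimal hn hmin
    have hz := hgood.last_ne_zero hα₁.adm hn1
    refine ⟨n, hn1, hz, ?_, hn, hmin⟩
    have hle := hα₀.adm.le_trunc hlt hn1 hz hn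
    have hadm := hgood.adm_trunc hα₁.adm hn1 (by
      rintro ⟨rfl, hodd⟩
      -- From α₀ 0 ≤ α₁ 0 = (M + 1)/2 and M - α₀ 0 ≤ α₀ 0 it follows that α₀ 0 = α₁ 0.
      refine hα₀.adm.not_agree hlt hn fun i hi => ?_
      obtain rfl : i = 0 := by omega
      have h2 : (α₀ 0 : ℕ) ≤ α₁ 0 := digit_le_of_lex_le hlt.le
      have h3 : ((reflect (shift 0 α₀) 0 : Fin (M + 1)) : ℕ) ≤ α₀ 0 :=
        digit_le_of_lex_le (hα₀.adm.reflect_le 0)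
      rw [reflect_val, shift_zero] at h3
      exact Fin.ext (by omega))
    rcases hle.lt_or_eq with h | h
    · exact (no_adm_between h0 h01 h1 hV hα₀ hα₁ hadm h (trunc_lt hn1 hz)).elim
    · exact toLex_inj.mp h
  · exfalso
    push Not at hex
    obtain ⟨p, hp, hplt⟩ := lex_lt_iff.mp hlt
    -- Length at least p + 2 puts the lowered digit beyond the first difference p and avoids the
    -- exceptional case of length one.
    obtain ⟨k, hk, hgood⟩ := hα₁.adm.exists_isGood hex (p + 2)
    have hz := hgood.last_ne_zero hα₁.adm (by omega)
    refine no_adm_between h0 h01 h1 hV hα₀ hα₁ (hgood.adm_trunc hα₁.adm (by omega) (by omega))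
      (lex_lt_iff.mpr ⟨p, fun i hi => ?_, ?_⟩) (trunc_lt (by omega) hz)
    · rw [hp i hi, trunc_of_lt (by omega)]
    · rw [trunc_of_lt (by omega)]
      exact hplt

lemma exists_isWordBase {q₀ q₁ : ℝ} (h0 : 1 < q₀) (h01 : q₀ < q₁) (h1 : q₁ < M + 1)
    (hV : ∀ p ∈ setV M, q₀ < p → q₁ ≤ p) {α₀ α₁ : DigitSeq M} (hα₀ : IsAlpha q₀ α₀)
    (hα₁ : IsAlpha q₁ α₁) (hstrict : ∀ n, shift n α₀ ≠ reflect α₀) :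
    ∃ n w, IsWordBase M n w q₀ ∧ IsWordBase M n w q₁ ∧ orbit q₀ w n = 0 ∧
      orbit q₁ w n = (M : ℝ) / (q₁ - 1) - 1 := by
  obtain ⟨n, hn1, hz, hα, hn, hmin⟩ := exists_word h0 h01 h1 hV hα₀ hα₁
  have hone : 1 < q₁ := h0.trans h01
  let w : ℕ → ℕ := fun i => α₁ i
  have ho0 := orbit_eq_val (w := w) (n := n - 1) h0 hα₀.val_eq
    (fun i hi => by rw [hα, trunc_of_lt hi])
  have ho1 := orbit_eq_val (w := w) (n := n) hone hα₁.val_eq (fun i hi => rfl)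
  have hlast : 1 ≤ w (n - 1) := Nat.one_le_iff_ne_zero.mpr fun h => hz (Fin.ext h)
  have htop0 : (M : ℝ) / (q₀ - 1) < 2 := by
    have h2 := hα₀.le_tail 0
    rw [shift_zero, hα₀.val_eq] at h2
    rcases h2.lt_or_eq with h | h
    · linarith
    · exact absurd (hα₀.shift_eq_reflect (i := 0) h0 (by rw [shift_zero, hα₀.val_eq, h]))
        (hstrict 0)
  have htop1 : (M : ℝ) / (q₁ - 1) < 2 := by
    refine lt_of_le_of_lt ?_ htop0
    have : 0 < q₀ - 1 := by linarith
    gcongr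
  refine ⟨n, w, ⟨h0, h01.trans h1, htop0, hn1, fun i => digit_le α₁ i, hlast, ?_, ?_⟩,
    ⟨hone, h1, htop1, hn1, fun i => digit_le α₁ i, hlast, ?_, ?_⟩, ?_, ?_⟩
  · intro i hi hin
    rw [ho0 i (by omega)]
    exact lt_of_le_of_ne (hα₀.le_tail i) fun h =>
      hstrict i (hα₀.shift_eq_reflect h0 h.symm)
  · intro i hi hin
    rw [ho0 i (by omega)]
    refine lt_of_le_of_ne (hα₀.tail_le i) fun h => ?_
    have h2 := hα₀.shift_eq h
    have h3 := shift_trunc_lt hα₁.adm hz hi hin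
    rw [← hα, h2] at h3
    exact lt_irrefl _ h3
  · intro i hi hin
    rw [ho1 i (by omega)]
    exact lt_of_le_of_ne (hα₁.le_tail i) fun h =>
      hmin i hin (hα₁.shift_eq_reflect hone h.symm)
  · intro i hi hin
    rw [ho1 i (by omega)]
    refine lt_of_le_of_ne (hα₁.tail_le i) fun h => ?_
    refine hmin (n - i) (by omega) ?_
    have h2 := hα₁.shift_eq h
    calc shift (n - i) α₁ = shift (n - i) (shift i α₁) := by rw [h2]
      _ = reflect α₁ := by rw [shift_shift, Nat.add_sub_cancel' hin.le, hn]
  -- The last digit of w is one more than that of α₀, whose n-th remainder is 1; hence the orbit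
  -- ends at 1 - 1 = 0.
  · obtain ⟨m, rfl⟩ : ∃ m, n = m + 1 := ⟨n - 1, by omega⟩
    rw [orbit, ho0 m (by simp)]
    have h2 := val_shift_succ h0 α₀ m
    have h3 : shift (m + 1) α₀ = α₀ := by rw [hα]; exact shift_trunc
    have h4 := trunc_last hn1 hz
    rw [← hα] at h4
    simp only [Nat.add_sub_cancel] at h4
    rw [h3, hα₀.val_eq] at h2
    have h5 : ((w m : ℕ) : ℝ) = (α₀ m : ℕ) + 1 := by
      change ((α₁ m : ℕ) : ℝ) = _
      rw [← h4]; push_cast; rfl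
    rw [h5]
    linarith
  · rw [ho1 n le_rfl, hn, val_reflect hone, hα₁.val_eq]

/-! ### Greedy expansions of 1 and the points a_i -/

/-- A finite expansion of `1` all of whose tails are smaller than one is greedy. -/
lemma aPoints_eq (hq : 1 < q) {c : DigitSeq M} {s : ℕ → ℝ} {N : ℕ} (hN : 1 ≤ N)
    (h0 : s 0 = 1) (hs : ∀ i, s (i + 1) = q * s i - (c i : ℕ)) (hlt : ∀ i, 1 ≤ i → s i < 1)
    (hnn : ∀ i, 0 ≤ s i) (hc : c (N - 1) ≠ 0) (hc' : ∀ i, N ≤ i → c i = 0) :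
    aPoints M q = s '' Set.Iio N := by
  have hval := val_eq_of_orbit hq hs (K := 1) fun i => by
    rw [abs_of_nonneg (hnn i)]
    rcases Nat.eq_zero_or_pos i with rfl | hi
    · exact h0.le
    · exact (hlt i hi).le
  have hval0 : val q c = 1 := by rw [← shift_zero c, hval, h0]
  have hg : IsGreedy q 1 c := by
    refine ⟨(isExpansion_iff hq).mpr hval0, fun d hd => ?_⟩
    by_contra hcd
    obtain ⟨j, hj, hjlt⟩ := lex_lt_iff.mp (not_le.mp hcd)
    have hd1 := (isExpansion_iff hq).mp hd
    have e1 := pow_mul_val_sub hq j hj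
    rw [hval0, hd1, sub_self, mul_zero] at e1
    have e2 := val_shift_succ hq c j
    have e3 := val_shift_succ hq d j
    have e4 : val q (shift j d) = val q (shift j c) := by linarith
    rw [e4] at e3
    have e5 := one_le_sub_of_lt hjlt
    have e6 := hlt (j + 1) (by omega)
    rw [← hval] at e6
    linarith [val_nonneg hq (shift (j + 1) d)]
  have hu : ∀ d : DigitSeq M, IsGreedy q 1 d → d = c := fun d hd =>
    toLex_inj.mp (le_antisymm (hg.2 d hd.1) (hd.2 c hg.1))
  ext x
  constructor
  · rintro ⟨d, i, hd, ⟨k, hik, hk⟩, hx⟩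
    obtain rfl := hu d hd
    refine ⟨i, ?_, ?_⟩
    · by_contra hiN
      exact hk (hc' k ((not_lt.mp hiN).trans hik))
    · rw [← hval]
      exact (isExpansion_iff hq).mp hx
  · rintro ⟨i, hi, rfl⟩
    have hi : i < N := hi
    exact ⟨c, i, hg, ⟨N - 1, by omega, hc⟩, (isExpansion_iff hq).mpr (hval i)⟩

lemma IsWordBase.aPoints_of_orbit_eq_zero {n : ℕ} {w : ℕ → ℕ} (h : IsWordBase M n w q)
    (hn : orbit q w n = 0) : aPoints M q = orbit q w '' Set.Iio n := by
  have hpos := h.pos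
  have htop := one_lt_top h.one_lt h.lt_succ
  have := aPoints_eq h.one_lt (M := M) (N := n)
    (c := fun i => if i < n then ⟨w i, Nat.lt_succ_of_le (h.digit_le i)⟩ else 0)
    (s := fun i => if i < n then orbit q w i else 0) h.pos ?_ (fun i => ?_) (fun i hi => ?_)
    (fun i => ?_) ?_ fun i hi => ?_
  · rw [this]
    refine Set.image_congr fun i hi => ?_
    rw [if_pos (Set.mem_Iio.mp hi)]
  · rw [if_pos (by omega), orbit]
  · rcases lt_trichotomy (i + 1) n with h1 | h1 | h1
    · rw [if_pos h1, if_pos (by omega), if_pos (by omega), orbit]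
    · rw [if_neg (by omega), if_pos (by omega), if_pos (by omega)]
      rw [← h1, orbit] at hn
      exact hn.symm
    · rw [if_neg (by omega), if_neg (by omega), if_neg (by omega)]
      simp
  · split_ifs with h1
    · exact h.orbit_lt i hi h1
    · exact one_pos
  · split_ifs with h1
    · rcases Nat.eq_zero_or_pos i with rfl | hi
      · simp [orbit]
      · linarith [h.lt_orbit i hi h1]
    · exact le_rfl
  · rw [if_pos (by omega)]
    intro h1
    have := congrArg Fin.val h1
    have := h.last_pos
    simp at *
    omega
  · rw [if_neg (by omega)]

lemma IsWordBase.aPoints_of_orbit_eq_reflect {n : ℕ} {w : ℕ → ℕ} (h : IsWordBase M n w q)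
    (hn : orbit q w n = (M : ℝ) / (q - 1) - 1) :
    aPoints M q = {x | ∃ i < n, x = orbit q w i ∨ x = (M : ℝ) / (q - 1) - orbit q w i} := by
  have hpos := h.pos
  have htop := one_lt_top h.one_lt h.lt_succ
  have htop2 := h.top_lt
  have hlast := h.last_pos
  -- The greedy expansion is w, then the reflection of w with last digit raised by one, then zeros.
  -- The remainders along the second block are the reflected orbit points.
  have := aPoints_eq h.one_lt (M := M) (N := 2 * n)
    (c := fun i => if i < n then ⟨w i, Nat.lt_succ_of_le (h.digit_le i)⟩ else
      if i < 2 * n - 1 then ⟨M - w (i - n), by omega⟩ else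
      if i = 2 * n - 1 then ⟨M - w (n - 1) + 1, by have := h.digit_le (n - 1); omega⟩ else 0)
    (s := fun i => if i < n then orbit q w i else if i < 2 * n then
      (M : ℝ) / (q - 1) - orbit q w (i - n) else 0)
    (by omega) ?_ (fun i => ?_) (fun i hi => ?_) (fun i => ?_) ?_ fun i hi => ?_
  · rw [this]
    ext x
    constructor
    · rintro ⟨i, hi, rfl⟩
      have hi : i < 2 * n := hi
      by_cases h1 : i < n
      · exact ⟨i, h1, Or.inl (if_pos h1)⟩
      · exact ⟨i - n, by omega, Or.inr (by simp only [if_neg h1, if_pos hi])⟩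
    · rintro ⟨i, hi, rfl | rfl⟩
      · exact ⟨i, Set.mem_Iio.mpr (by omega), if_pos hi⟩
      · refine ⟨n + i, Set.mem_Iio.mpr (by omega), ?_⟩
        simp only [if_neg (show ¬ n + i < n by omega), if_pos (show n + i < 2 * n by omega),
          Nat.add_sub_cancel_left]
  · rw [if_pos (by omega), orbit]
  · have hmt := mul_top (M := M) h.one_lt
    by_cases h1 : i + 1 < n
    · rw [if_pos h1, if_pos (by omega), if_pos (by omega), orbit]
    by_cases h2 : i + 1 = n
    · rw [if_neg (by omega), if_pos (by omega), if_pos (by omega), if_pos (by omega),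
        show i + 1 - n = 0 by omega]
      rw [← h2, orbit] at hn
      simp only [orbit]
      linarith
    by_cases h3 : i + 1 < 2 * n
    · rw [if_neg (by omega), if_pos (by omega), if_neg (by omega), if_pos (by omega),
        if_neg (by omega), if_pos (by omega), show i + 1 - n = i - n + 1 by omega, orbit]
      simp only
      rw [Nat.cast_sub (h.digit_le _)]
      linarith
    by_cases h4 : i + 1 = 2 * n
    · rw [if_neg (by omega), if_neg (by omega), if_neg (by omega), if_pos (by omega),
        if_neg (by omega), if_neg (by omega), if_pos (by omega), show i - n = n - 1 by omega]
      rw [show n = n - 1 + 1 by omega, orbit] at hn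
      simp only
      push_cast [Nat.cast_sub (h.digit_le (n - 1))]
      linarith
    · rw [if_neg (by omega), if_neg (by omega), if_neg (by omega), if_neg (by omega),
        if_neg (by omega), if_neg (by omega), if_neg (by omega)]
      simp
  · split_ifs with h1 h2
    · exact h.orbit_lt i hi h1
    · rcases Nat.eq_zero_or_pos (i - n) with h3 | h3
      · rw [h3, orbit]; linarith
      · linarith [h.lt_orbit (i - n) h3 (by omega)]
    · exact one_pos
  · split_ifs with h1 h2
    · rcases Nat.eq_zero_or_pos i with rfl | hi
      · simp [orbit]
      · linarith [h.lt_orbit i hi h1]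
    · rcases Nat.eq_zero_or_pos (i - n) with h3 | h3
      · rw [h3, orbit]; linarith
      · linarith [h.orbit_lt (i - n) h3 (by omega)]
    · exact le_rfl
  · rw [if_neg (by omega), if_neg (by omega), if_pos rfl]
    intro h1
    have := congrArg Fin.val h1
    simp at this
  · rw [if_neg (by omega), if_neg (by omega), if_neg (by omega)]

/-- If l were outside the closure of U, the connected set [l, r) would fit into the component, which
does not contain l. -/
lemma IsGap.spec {l r : ℝ} (h : IsGap M l r) (hl : 1 < l) :
    l ∈ closure (setU M) ∧ Set.Ioo l r ⊆ Set.Ioo (1 : ℝ) (M + 1) \ closure (setU M) := by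
  obtain ⟨x, hx, hxc⟩ := h
  have hsub := connectedComponentIn_subset (Set.Ioo (1 : ℝ) (M + 1) \ closure (setU M)) x
  rw [hxc] at hsub
  have hxm : x ∈ Set.Ioo l r := hxc ▸ mem_connectedComponentIn hx
  refine ⟨?_, hsub⟩
  by_contra hlU
  have hlr : l < r := hxm.1.trans hxm.2
  have hIco : Set.Ico l r ⊆ connectedComponentIn (Set.Ioo (1 : ℝ) (M + 1) \ closure (setU M)) x := by
    refine isPreconnected_Ico.subset_connectedComponentIn ⟨hxm.1.le, hxm.2⟩ fun y hy => ?_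
    rcases hy.1.eq_or_lt with h | h
    · rw [← h]
      exact ⟨⟨hl, hxm.1.trans (hsub hxm).1.2⟩, hlU⟩
    · exact hsub ⟨h, hy.2⟩
  rw [hxc] at hIco
  exact lt_irrefl _ (hIco ⟨le_rfl, hlr⟩).1

lemma exists_isWordBase_of_isGap (hM : 1 ≤ M) {q₀ r q₁ : ℝ} (hgap : IsGap M q₀ r) (hq₀ : 1 < q₀)
    (hq₁ : IsLeast (setV M ∩ Set.Ioo q₀ r) q₁) :
    ∃ n w, IsWordBase M n w q₀ ∧ IsWordBase M n w q₁ ∧ orbit q₀ w n = 0 ∧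
      orbit q₁ w n = (M : ℝ) / (q₁ - 1) - 1 := by
  obtain ⟨hcl, hsub⟩ := hgap.spec hq₀
  obtain ⟨⟨hV, h01, h1r⟩, hleast⟩ := hq₁
  have h1 : q₁ < M + 1 := (hsub ⟨h01, h1r⟩).1.2
  obtain ⟨α₀, hα₀, hstrict⟩ := exists_isAlpha_of_mem_closure hM hq₀ (h01.trans h1) hcl
  obtain ⟨α₁, hα₁⟩ := exists_isAlpha_of_mem_setV h1 hV
  refine exists_isWordBase hq₀ h01 h1 (fun p hp hp0 => ?_) hα₀ hα₁ hstrict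
  by_contra hlt
  exact hlt (hleast ⟨hp, hp0, (not_le.mp hlt).trans h1r⟩)

/-! ### Base-independent names for the endpoints -/

variable {n : ℕ} {w : ℕ → ℕ}

/-- The digits of the word `w` and, for the sign `false`, of its reflection. -/
def digit (M : ℕ) (w : ℕ → ℕ) : Bool → ℕ → ℕ
  | true, i => w i
  | false, i => M - w i

/-- The points of the orbit of `1` and, for the sign `false`, their reflections. -/
noncomputable def orbitPt (M : ℕ) (w : ℕ → ℕ) (q : ℝ) : Bool → ℕ → ℝ
  | true, i => orbit q w i
  | false, i => (M : ℝ) / (q - 1) - orbit q w i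

/-- Names for the endpoints of the vertices: `pt k ε i` stands for the point that the map
`x ↦ q x - k` sends to the orbit point with sign `ε` and index `i`. -/
inductive Label : Type
  | bot : Label
  | top : Label
  | pt (k : ℕ) (ε : Bool) (i : ℕ) : Label

namespace Label

/-- The point named by a label in base `q`. -/
noncomputable def eval (M : ℕ) (w : ℕ → ℕ) (q : ℝ) : Label → ℝ
  | bot => 0
  | top => (M : ℝ) / (q - 1)
  | pt k ε i => (k + orbitPt M w q ε i) / q

/-- The labels in use. -/
def Valid (M n : ℕ) (w : ℕ → ℕ) : Label → Prop
  | bot => True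
  | top => True
  | pt k ε i => i < n ∧ k ≤ M ∧ (i = 0 → ε = true → k < M) ∧ (i = 0 → ε = false → 0 < k) ∧
      (1 ≤ i → k = digit M w ε (i - 1))

/-- The left endpoint of the `k`-th interval of the switch region. -/
def switchLeft (k : ℕ) : Label := pt k true 0

/-- The right endpoint of the `k`-th interval of the switch region. -/
def switchRight (k : ℕ) : Label := pt (k + 1) false 0

end Label

open Label

lemma digit_le' (hw : ∀ i, w i ≤ M) (ε : Bool) (i : ℕ) : digit M w ε i ≤ M := by
  cases ε
  · exact Nat.sub_le _ _
  · exact hw i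

/-- Offsets less than one apart leave the comparison to the integers; offsets in the opposite order
cost one unit (`natCast_add_le_iff'`). -/
lemma natCast_add_le_iff {a b : ℕ} {x y : ℝ} (h : x ≤ y) (h' : y < x + 1) :
    (a : ℝ) + x ≤ b + y ↔ a ≤ b := by
  constructor
  · intro hab
    by_contra hlt
    have : (b : ℝ) + 1 ≤ a := by exact_mod_cast not_le.mp hlt
    linarith
  · intro hab
    have : (a : ℝ) ≤ b := by exact_mod_cast hab
    linarith

lemma natCast_add_le_iff' {a b : ℕ} {x y : ℝ} (h : y < x) (h' : x ≤ y + 1) :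
    (a : ℝ) + x ≤ b + y ↔ a + 1 ≤ b := by
  have := natCast_add_le_iff (a := a + 1) (b := b) (x := x - 1) (y := y) (by linarith)
    (by linarith)
  rw [← this]
  push_cast
  constructor <;> intro <;> linarith


lemma IsWordBase.q_pos (h : IsWordBase M n w q) : 0 < q := by linarith [h.one_lt]

lemma IsWordBase.one_lt_top (h : IsWordBase M n w q) : 1 < (M : ℝ) / (q - 1) :=
  Univoque.one_lt_top h.one_lt h.lt_succ

lemma IsWordBase.mul_orbitPt (h : IsWordBase M n w q) (ε : Bool) (i : ℕ) :
    q * orbitPt M w q ε i = digit M w ε i + orbitPt M w q ε (i + 1) := by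
  cases ε
  · simp only [orbitPt, orbit, digit, Nat.cast_sub (h.digit_le i), mul_sub, mul_top h.one_lt]
    ring
  · simp [orbitPt, orbit, digit]

lemma IsWordBase.lt_orbitPt (h : IsWordBase M n w q) (ε : Bool) {i : ℕ} (hi : 1 ≤ i)
    (hin : i < n) : (M : ℝ) / (q - 1) - 1 < orbitPt M w q ε i := by
  cases ε
  · simp only [orbitPt]; linarith [h.orbit_lt i hi hin]
  · exact h.lt_orbit i hi hin

lemma IsWordBase.orbitPt_lt (h : IsWordBase M n w q) (ε : Bool) {i : ℕ} (hi : 1 ≤ i)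
    (hin : i < n) : orbitPt M w q ε i < 1 := by
  cases ε
  · simp only [orbitPt]; linarith [h.lt_orbit i hi hin]
  · exact h.orbit_lt i hi hin

@[simp] lemma orbitPt_true_zero : orbitPt M w q true 0 = 1 := rfl

@[simp] lemma orbitPt_false_zero : orbitPt M w q false 0 = (M : ℝ) / (q - 1) - 1 := rfl

lemma IsWordBase.le_orbitPt (h : IsWordBase M n w q) (ε : Bool) {i : ℕ} (hin : i < n) :
    (M : ℝ) / (q - 1) - 1 ≤ orbitPt M w q ε i := by
  rcases Nat.eq_zero_or_pos i with rfl | hi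
  · cases ε
    · simp
    · simp; linarith [h.top_lt]
  · exact (h.lt_orbitPt ε hi hin).le

lemma IsWordBase.orbitPt_le (h : IsWordBase M n w q) (ε : Bool) {i : ℕ} (hin : i < n) :
    orbitPt M w q ε i ≤ 1 := by
  rcases Nat.eq_zero_or_pos i with rfl | hi
  · cases ε
    · simp; linarith [h.top_lt]
    · simp
  · exact (h.orbitPt_lt ε hi hin).le

lemma IsWordBase.orbitPt_lt_add_one (h : IsWordBase M n w q) (ε ε' : Bool) {i j : ℕ}
    (hi : i < n) (hj : j < n) : orbitPt M w q ε i < orbitPt M w q ε' j + 1 := by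
  linarith [h.orbitPt_le ε hi, h.le_orbitPt ε' hj, h.one_lt_top]

lemma IsWordBase.eval_pt_le_iff (h : IsWordBase M n w q) {k k' i i' : ℕ} {ε ε' : Bool} :
    eval M w q (pt k ε i) ≤ eval M w q (pt k' ε' i') ↔
      (k : ℝ) + orbitPt M w q ε i ≤ k' + orbitPt M w q ε' i' :=
  div_le_div_iff_of_pos_right h.q_pos

lemma IsWordBase.eval_pt_lt_iff (h : IsWordBase M n w q) {k k' i i' : ℕ} {ε ε' : Bool} :
    eval M w q (pt k ε i) < eval M w q (pt k' ε' i') ↔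
      (k : ℝ) + orbitPt M w q ε i < k' + orbitPt M w q ε' i' :=
  div_lt_div_iff_of_pos_right h.q_pos

lemma IsWordBase.eval_pt_pos (h : IsWordBase M n w q) {k i : ℕ} {ε : Bool}
    (hx : Valid M n w (pt k ε i)) : 0 < eval M w q (pt k ε i) := by
  have := h.le_orbitPt ε hx.1
  have := h.one_lt_top
  exact div_pos (by linarith [Nat.cast_nonneg (α := ℝ) k]) h.q_pos

lemma IsWordBase.eval_pt_lt_top (h : IsWordBase M n w q) {k i : ℕ} {ε : Bool}
    (hx : Valid M n w (pt k ε i)) : eval M w q (pt k ε i) < (M : ℝ) / (q - 1) := by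
  have := h.orbitPt_le ε hx.1
  have := h.one_lt_top
  have hk : (k : ℝ) ≤ M := by exact_mod_cast hx.2.1
  change (_ : ℝ) / q < _
  rw [div_lt_iff₀ h.q_pos, mul_comm, mul_top h.one_lt]
  linarith

lemma IsWordBase.eval_nonneg (h : IsWordBase M n w q) {x : Label} (hx : Valid M n w x) :
    0 ≤ eval M w q x := by
  rcases x with _ | _ | ⟨k, ε, i⟩
  · exact le_rfl
  · change 0 ≤ (M : ℝ) / (q - 1); linarith [h.one_lt_top]
  · exact (h.eval_pt_pos hx).le

lemma IsWordBase.eval_le_top (h : IsWordBase M n w q) {x : Label} (hx : Valid M n w x) :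
    eval M w q x ≤ (M : ℝ) / (q - 1) := by
  rcases x with _ | _ | ⟨k, ε, i⟩
  · change 0 ≤ (M : ℝ) / (q - 1); linarith [h.one_lt_top]
  · exact le_rfl
  · exact (h.eval_pt_lt_top hx).le

lemma valid_left (hn : 1 ≤ n) {k : ℕ} (hk : k < M) : Valid M n w (switchLeft k) :=
  ⟨by omega, by omega, by simp [hk], by simp, by omega⟩

lemma valid_right (hn : 1 ≤ n) {k : ℕ} (hk : k < M) : Valid M n w (switchRight k) :=
  ⟨by omega, by omega, by simp, by simp, by omega⟩

lemma valid_pt_digit (hw : ∀ i, w i ≤ M) (ε : Bool) {i : ℕ} (hi : i + 1 < n) :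
    Valid M n w (pt (digit M w ε i) ε (i + 1)) :=
  ⟨hi, digit_le' hw ε i, by omega, by omega, by simp⟩

lemma IsWordBase.eval_pt_digit (h : IsWordBase M n w q) (ε : Bool) (i : ℕ) :
    eval M w q (pt (digit M w ε i) ε (i + 1)) = orbitPt M w q ε i := by
  change (_ : ℝ) / q = _
  rw [← h.mul_orbitPt, mul_div_cancel_left₀ _ h.q_pos.ne']

lemma eval_left (k : ℕ) : eval M w q (switchLeft k) = ((k : ℝ) + 1) / q := rfl

lemma eval_right (k : ℕ) :
    eval M w q (switchRight k) = (((k : ℝ) + 1) + ((M : ℝ) / (q - 1) - 1)) / q := by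
  simp [eval, switchRight]

lemma IsWordBase.left_lt_right (h : IsWordBase M n w q) (k : ℕ) :
    eval M w q (switchLeft k) < eval M w q (switchRight k) := by
  rw [eval_left, eval_right]
  exact div_lt_div_of_pos_right (by linarith [h.one_lt_top]) h.q_pos

lemma IsWordBase.right_lt_left (h : IsWordBase M n w q) {k l : ℕ} (hkl : k < l) :
    eval M w q (switchRight k) < eval M w q (switchLeft l) := by
  rw [eval_left, eval_right]
  have : (k : ℝ) + 1 ≤ l := by exact_mod_cast hkl
  exact div_lt_div_of_pos_right (by linarith [h.top_lt]) h.q_pos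

/-- No label names an interior point of the switch region. -/
lemma IsWordBase.not_between (h : IsWordBase M n w q) {k : ℕ} (hk : k < M) {z : Label}
    (hz : Valid M n w z) (h1 : eval M w q (switchLeft k) < eval M w q z) :
    eval M w q (switchRight k) ≤ eval M w q z := by
  rcases z with _ | _ | ⟨j, ε, i⟩
  · exact absurd h1 (not_lt.mpr (h.eval_nonneg (valid_left h.pos hk)))
  · exact h.eval_le_top (valid_right h.pos hk)
  · rw [switchLeft, h.eval_pt_lt_iff] at h1
    rw [switchRight, h.eval_pt_le_iff]
    have h2 := h.orbitPt_le ε hz.1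
    have h3 := h.le_orbitPt ε hz.1
    simp only [orbitPt_true_zero, orbitPt_false_zero] at *
    have : (k : ℝ) < j := by linarith
    have : ((k + 1 : ℕ) : ℝ) ≤ j := by exact_mod_cast this
    linarith

/-! ### The order of the names in the two bases -/

section compare

variable {q₀ q₁ : ℝ}

/-- The orbit points are ordered in the same way in the two bases. -/
lemma orbitPt_le_iff (h₀ : IsWordBase M n w q₀) (h₁ : IsWordBase M n w q₁)
    (e₀ : orbit q₀ w n = 0) (e₁ : orbit q₁ w n = (M : ℝ) / (q₁ - 1) - 1) (m : ℕ) :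
    ∀ i j ε ε', i + m = n → j < n → i < n → (i = j → ε ≠ ε' → Even M) →
      ((orbitPt M w q₀ ε i ≤ orbitPt M w q₀ ε' j ↔ orbitPt M w q₁ ε i ≤ orbitPt M w q₁ ε' j)) := by
  have hlast := h₀.last_pos
  have hwn := h₀.digit_le (n - 1)
  have t0 := h₀.one_lt_top
  have t0' := h₀.top_lt
  have t1 := h₁.one_lt_top
  have t1' := h₁.top_lt
  have key : ∀ {q : ℝ}, IsWordBase M n w q → ∀ i j ε ε',
      (orbitPt M w q ε i ≤ orbitPt M w q ε' j ↔
        (digit M w ε i : ℝ) + orbitPt M w q ε (i + 1) ≤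
          digit M w ε' j + orbitPt M w q ε' (j + 1)) := fun hb i j ε ε' => by
    rw [← hb.mul_orbitPt, ← hb.mul_orbitPt]
    exact (mul_le_mul_iff_right₀ hb.q_pos).symm
  have E0t : orbitPt M w q₀ true n = 0 := e₀
  have E0f : orbitPt M w q₀ false n = (M : ℝ) / (q₀ - 1) := by simp only [orbitPt, e₀]; ring
  have E1t : orbitPt M w q₁ true n = (M : ℝ) / (q₁ - 1) - 1 := e₁
  have E1f : orbitPt M w q₁ false n = 1 := by simp only [orbitPt, e₁]; ring
  -- Multiplication by q turns a comparison at times i, j into one of digits plus points at times i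
  -- + 1, j + 1; the induction runs backwards from the end of w.
  induction m with
  | zero => intros; omega
  | succ m ih =>
  intro i j ε ε' him hj hi hpar
  rw [key h₀, key h₁]
  by_cases hi' : i + 1 < n
  · have a0 := h₀.lt_orbitPt ε (by omega) hi'
    have a0' := h₀.orbitPt_lt ε (by omega) hi'
    have a1 := h₁.lt_orbitPt ε (by omega) hi'
    have a1' := h₁.orbitPt_lt ε (by omega) hi'
    by_cases hj' : j + 1 < n
    · rcases lt_trichotomy (digit M w ε i) (digit M w ε' j) with hd | hd | hd
      · have : (digit M w ε i : ℝ) + 1 ≤ digit M w ε' j := by exact_mod_cast hd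
        have b0 := h₀.orbitPt_lt_add_one ε ε' hi' hj'
        have b1 := h₁.orbitPt_lt_add_one ε ε' hi' hj'
        constructor <;> intro <;> linarith
      · rw [hd, add_le_add_iff_left, add_le_add_iff_left]
        exact ih _ _ _ _ (by omega) hj' hi' fun h => hpar (by omega)
      · have : (digit M w ε' j : ℝ) + 1 ≤ digit M w ε i := by exact_mod_cast hd
        have b0 := h₀.orbitPt_lt_add_one ε' ε hj' hi'
        have b1 := h₁.orbitPt_lt_add_one ε' ε hj' hi'
        constructor <;> intro <;> linarith
    · obtain rfl : n = j + 1 := by omega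
      -- The end point differs in the two bases, but it lies on the same side of every intermediate
      -- point and at distance at most one, so the same comparison of digits decides.
      cases ε' <;> simp only [E0t, E0f, E1t, E1f]
      · rw [natCast_add_le_iff (by linarith) (by linarith),
          natCast_add_le_iff (by linarith) (by linarith)]
      · rw [natCast_add_le_iff' (by linarith) (by linarith),
          natCast_add_le_iff' (by linarith) (by linarith)]
  · obtain rfl : n = i + 1 := by omega
    by_cases hj' : j + 1 < i + 1
    · have a0 := h₀.lt_orbitPt ε' (by omega) hj'
      have a0' := h₀.orbitPt_lt ε' (by omega) hj'
      have a1 := h₁.lt_orbitPt ε' (by omega) hj'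
      have a1' := h₁.orbitPt_lt ε' (by omega) hj'
      cases ε <;> simp only [E0t, E0f, E1t, E1f]
      · rw [natCast_add_le_iff' (by linarith) (by linarith),
          natCast_add_le_iff' (by linarith) (by linarith)]
      · rw [natCast_add_le_iff (by linarith) (by linarith),
          natCast_add_le_iff (by linarith) (by linarith)]
    · obtain rfl : i = j := by omega
      simp only [Nat.add_sub_cancel] at hwn hlast
      cases ε <;> cases ε'
      · simp
      -- The two bases could disagree only for 2 w i = M + 1, which an even M excludes.
      · obtain ⟨r, hr⟩ := hpar rfl (by simp)
        simp only [E0t, E0f, E1t, E1f, digit]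
        have c0 := natCast_add_le_iff' (a := M - w i + 1) (b := w i)
          (x := (M : ℝ) / (q₀ - 1) - 1) (y := 0) (by linarith) (by linarith)
        have c1 := natCast_add_le_iff' (a := M - w i) (b := w i)
          (x := 1) (y := (M : ℝ) / (q₁ - 1) - 1)
          (by linarith) (by linarith)
        rw [c1, show M - w i + 1 ≤ w i ↔ M - w i + 1 + 1 ≤ w i by omega, ← c0]
        push_cast
        constructor <;> intro <;> linarith
      · obtain ⟨r, hr⟩ := hpar rfl (by simp)
        simp only [E0t, E0f, E1t, E1f, digit]
        have c0 := natCast_add_le_iff (a := w i) (b := M - w i + 1)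
          (x := 0) (y := (M : ℝ) / (q₀ - 1) - 1) (by linarith) (by linarith)
        have c1 := natCast_add_le_iff (a := w i) (b := M - w i)
          (x := (M : ℝ) / (q₁ - 1) - 1) (y := 1)
          (by linarith) (by linarith)
        rw [c1, show w i ≤ M - w i ↔ w i ≤ M - w i + 1 by omega, ← c0]
        push_cast
        constructor <;> intro <;> linarith
      · simp

/-- The labels are ordered in the same way in the two bases. -/
lemma eval_le_iff (h₀ : IsWordBase M n w q₀) (h₁ : IsWordBase M n w q₁)
    (e₀ : orbit q₀ w n = 0) (e₁ : orbit q₁ w n = (M : ℝ) / (q₁ - 1) - 1) {x y : Label}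
    (hx : Valid M n w x) (hy : Valid M n w y) :
    eval M w q₀ x ≤ eval M w q₀ y ↔ eval M w q₁ x ≤ eval M w q₁ y := by
  rcases x with _ | _ | ⟨k, ε, i⟩
  · exact iff_of_true (h₀.eval_nonneg hy) (h₁.eval_nonneg hy)
  · rcases y with _ | _ | ⟨k', ε', i'⟩
    · refine iff_of_false (not_le.mpr ?_) (not_le.mpr ?_)
      · change 0 < (M : ℝ) / (q₀ - 1); linarith [h₀.one_lt_top]
      · change 0 < (M : ℝ) / (q₁ - 1); linarith [h₁.one_lt_top]
    · exact iff_of_true le_rfl le_rfl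
    · exact iff_of_false (not_le.mpr (h₀.eval_pt_lt_top hy)) (not_le.mpr (h₁.eval_pt_lt_top hy))
  · rcases y with _ | _ | ⟨k', ε', i'⟩
    · exact iff_of_false (not_le.mpr (h₀.eval_pt_pos hx)) (not_le.mpr (h₁.eval_pt_pos hx))
    · exact iff_of_true (h₀.eval_pt_lt_top hx).le (h₁.eval_pt_lt_top hx).le
    · rw [h₀.eval_pt_le_iff, h₁.eval_pt_le_iff]
      rcases lt_trichotomy k k' with hk | rfl | hk
      · have : (k : ℝ) + 1 ≤ k' := by exact_mod_cast hk
        have b0 := h₀.orbitPt_lt_add_one ε ε' hx.1 hy.1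
        have b1 := h₁.orbitPt_lt_add_one ε ε' hx.1 hy.1
        constructor <;> intro <;> linarith
      · rw [add_le_add_iff_left, add_le_add_iff_left]
        by_cases hpar : i = i' → ε ≠ ε' → Even M
        · exact orbitPt_le_iff h₀ h₁ e₀ e₁ (n - i) i i' ε ε' (by have := hx.1; omega) hy.1 hx.1
            hpar
        · push Not at hpar
          obtain ⟨rfl, hne, hodd⟩ := hpar
          rcases Nat.eq_zero_or_pos i with rfl | hi
          · have := h₀.top_lt
            have := h₁.top_lt
            cases ε <;> cases ε'
            · exact absurd rfl hne
            · simp only [orbitPt_true_zero, orbitPt_false_zero]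
              constructor <;> intro <;> linarith
            · simp only [orbitPt_true_zero, orbitPt_false_zero]
              constructor <;> intro <;> linarith
            · exact absurd rfl hne
          -- Labels with equal k and opposite signs at a time i ≥ 1 give w (i - 1) = M - w (i - 1),
          -- so M is even after all.
          · exfalso
            have d1 := hx.2.2.2.2 hi
            have d2 := hy.2.2.2.2 hi
            have d3 := h₀.digit_le (i - 1)
            refine hodd ⟨w (i - 1), ?_⟩
            cases ε <;> cases ε' <;> simp only [digit] at d1 d2 <;> first | omega | simp at hne
      · have : (k' : ℝ) + 1 ≤ k := by exact_mod_cast hk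
        have b0 := h₀.orbitPt_lt_add_one ε' ε hy.1 hx.1
        have b1 := h₁.orbitPt_lt_add_one ε' ε hy.1 hx.1
        constructor <;> intro <;> linarith

end compare

/-! ### Vertices as pairs of consecutive names -/

/-- The interval of the switch region that has the last orbit point as one of its endpoints. -/
def lastIndex (M n : ℕ) (w : ℕ → ℕ) : Bool → ℕ
  | true => w (n - 1) - 1
  | false => M - w (n - 1)

/-- A base in which the orbit of `1` along the word `w` describes the vertices of the graph. -/
structure IsGraphBase (M n : ℕ) (w : ℕ → ℕ) (q : ℝ) : Prop extends IsWordBase M n w q where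
  points : aPoints M q ∪ bPoints M q = {x | ∃ ε, ∃ i < n, x = orbitPt M w q ε i}
  last : ∀ ε, orbitPt M w q ε (n - 1) = eval M w q (switchLeft (lastIndex M n w ε)) ∨
    orbitPt M w q ε (n - 1) = eval M w q (switchRight (lastIndex M n w ε))

lemma IsWordBase.orbitPt_last (h : IsWordBase M n w q) (ε : Bool) :
    orbitPt M w q ε (n - 1) = (digit M w ε (n - 1) + orbitPt M w q ε n) / q := by
  have h1 := h.mul_orbitPt ε (n - 1)
  rw [Nat.sub_add_cancel h.pos] at h1
  rw [← h1, mul_div_cancel_left₀ _ h.q_pos.ne']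

lemma IsWordBase.isGraphBase_of_orbit_eq_zero (h : IsWordBase M n w q) (hn : orbit q w n = 0) :
    IsGraphBase M n w q := by
  refine ⟨h, ?_, fun ε => ?_⟩
  · have ha := h.aPoints_of_orbit_eq_zero hn
    ext x
    constructor
    · rintro (hx | ⟨a, hx, rfl⟩)
      · rw [ha] at hx
        obtain ⟨i, hi, rfl⟩ := hx
        exact ⟨true, i, hi, rfl⟩
      · rw [ha] at hx
        obtain ⟨i, hi, rfl⟩ := hx
        exact ⟨false, i, hi, rfl⟩
    · rintro ⟨_ | _, i, hi, rfl⟩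
      · exact Or.inr ⟨orbit q w i, by rw [ha]; exact ⟨i, hi, rfl⟩, rfl⟩
      · exact Or.inl (by rw [ha]; exact ⟨i, hi, rfl⟩)
  · rw [h.orbitPt_last, eval_left, eval_right]
    cases ε
    · right
      simp only [digit, orbitPt, hn, lastIndex]
      ring
    · left
      simp only [digit, orbitPt, hn, lastIndex, Nat.cast_sub h.last_pos]
      ring

/-- Compared with an orbit ending at 0, the last points sit at the opposite ends of the switch
intervals with the same indices. -/
lemma IsWordBase.isGraphBase_of_orbit_eq_reflect (h : IsWordBase M n w q)
    (hn : orbit q w n = (M : ℝ) / (q - 1) - 1) : IsGraphBase M n w q := by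
  refine ⟨h, ?_, fun ε => ?_⟩
  · have ha := h.aPoints_of_orbit_eq_reflect hn
    ext x
    constructor
    · rintro (hx | ⟨a, hx, rfl⟩)
      · rw [ha] at hx
        obtain ⟨i, hi, rfl | rfl⟩ := hx
        · exact ⟨true, i, hi, rfl⟩
        · exact ⟨false, i, hi, rfl⟩
      · rw [ha] at hx
        obtain ⟨i, hi, rfl | rfl⟩ := hx
        · exact ⟨false, i, hi, rfl⟩
        · exact ⟨true, i, hi, by simp [orbitPt]⟩
    · rintro ⟨_ | _, i, hi, rfl⟩
      · exact Or.inl (by rw [ha]; exact ⟨i, hi, Or.inr rfl⟩)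
      · exact Or.inl (by rw [ha]; exact ⟨i, hi, Or.inl rfl⟩)
  · rw [h.orbitPt_last, eval_left, eval_right]
    cases ε
    · left
      simp only [digit, orbitPt, hn, lastIndex]
      ring
    · right
      simp only [digit, orbitPt, hn, lastIndex, Nat.cast_sub h.last_pos]
      ring

lemma IsWordBase.mem_switchRegion_iff (h : IsWordBase M n w q) {x : ℝ} :
    x ∈ switchRegion M q ↔
      ∃ k < M, x ∈ Set.Icc (eval M w q (switchLeft k)) (eval M w q (switchRight k)) := by
  have hq := h.q_pos
  have hq1 : q - 1 ≠ 0 := by linarith [h.one_lt]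
  have e : ∀ k : ℕ, eval M w q (switchRight k)
      = (((k + 1 : ℕ) : ℝ) - 1) / q + (M : ℝ) / (q ^ 2 - q) := by
    intro k
    rw [eval_right, show q ^ 2 - q = q * (q - 1) by ring]
    push_cast
    field_simp
    ring
  have e' : ∀ k : ℕ, eval M w q (switchLeft k) = ((k + 1 : ℕ) : ℝ) / q := by
    intro k
    rw [eval_left]
    push_cast
    rfl
  constructor
  · rintro ⟨j, hj1, hj2, hx⟩
    obtain ⟨k, rfl⟩ : ∃ k, j = k + 1 := ⟨j - 1, by omega⟩
    exact ⟨k, by omega, by rw [e, e']; exact hx⟩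
  · rintro ⟨k, hk, hx⟩
    rw [e, e'] at hx
    exact ⟨k + 1, by omega, by omega, hx⟩

lemma connectedComponentIn_eq_Ioo {R : Set ℝ} {a b p : ℝ} (hsub : Set.Ioo a b ⊆ R) (ha : a ∉ R)
    (hb : b ∉ R) (hp : p ∈ Set.Ioo a b) : connectedComponentIn R p = Set.Ioo a b := by
  refine Set.Subset.antisymm (fun y hy => ?_)
    (isPreconnected_Ioo.subset_connectedComponentIn hp hsub)
  have hord := (isPreconnected_connectedComponentIn (F := R) (x := p)).ordConnected
  have hpm : p ∈ connectedComponentIn R p := mem_connectedComponentIn (hsub hp)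
  have hCR := connectedComponentIn_subset R p
  constructor
  · by_contra hya
    exact ha (hCR (hord.out hy hpm ⟨not_lt.mp hya, hp.1.le⟩))
  · by_contra hyb
    exact hb (hCR (hord.out hpm hy ⟨hp.2.le, not_lt.mp hyb⟩))

lemma finite_valid : {x | Valid M n w x}.Finite := by
  have : {x | Valid M n w x} ⊆ {bot, top} ∪
      (fun p : ℕ × Bool × ℕ => pt p.1 p.2.1 p.2.2) ''
        (Set.Iic M ×ˢ (Set.univ ×ˢ Set.Iio n)) := by
    rintro (_ | _ | ⟨k, ε, i⟩) hx
    · simp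
    · simp
    · exact Or.inr ⟨(k, ε, i), ⟨hx.2.1, trivial, hx.1⟩, rfl⟩
  refine Set.Finite.subset ?_ this
  exact (Set.toFinite _).union
    (((Set.finite_Iic M).prod (Set.finite_univ.prod (Set.finite_Iio n))).image _)

/-- `x` and `y` name the endpoints of a vertex. -/
structure IsVertexPair (M n : ℕ) (w : ℕ → ℕ) (q : ℝ) (x y : Label) : Prop where
  valid_left : Valid M n w x
  valid_right : Valid M n w y
  lt : eval M w q x < eval M w q y
  not_between : ∀ z, Valid M n w z → eval M w q x < eval M w q z →
    eval M w q y ≤ eval M w q z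
  ne_left : ∀ k < M, eval M w q x ≠ eval M w q (switchLeft k)

/-- No name lies strictly inside a switch interval, so the neighbour below its right end is its left
end, which `ne_left` rules out. -/
lemma IsVertexPair.ne_right (h : IsWordBase M n w q) {x y : Label}
    (hxy : IsVertexPair M n w q x y) {k : ℕ} (hk : k < M) :
    eval M w q y ≠ eval M w q (switchRight k) := by
  intro hy
  have hlr := h.left_lt_right k
  have h1 : eval M w q (switchLeft k) ≤ eval M w q x := by
    by_contra hlt
    have := hxy.not_between _ (Univoque.valid_left h.pos hk) (not_le.mp hlt)
    linarith
  rcases h1.eq_or_lt with h2 | h2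
  · exact hxy.ne_left k hk h2.symm
  · have := h.not_between hk hxy.valid_left h2
    linarith [hxy.lt]

/-- The label that bounds the image of `pt k ε i` under `x ↦ q x - k` when it is compared with
left endpoints of vertices. -/
def imageLeft (M n : ℕ) (w : ℕ → ℕ) (ε : Bool) (i : ℕ) : Label :=
  if i + 1 < n then pt (digit M w ε i) ε (i + 1) else switchRight (lastIndex M n w ε)

/-- The label that bounds the image of `pt k ε i` under `x ↦ q x - k` when it is compared with
right endpoints of vertices. -/
def imageRight (M n : ℕ) (w : ℕ → ℕ) (ε : Bool) (i : ℕ) : Label :=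
  if i + 1 < n then pt (digit M w ε i) ε (i + 1) else switchLeft (lastIndex M n w ε)

namespace IsGraphBase

lemma eval_notMem (h : IsGraphBase M n w q) {z : Label} (hz : Valid M n w z) :
    eval M w q z ∉ vertexRegion M q := by
  rintro ⟨hI, hnot⟩
  rcases z with _ | _ | ⟨k, ε, i⟩
  · exact lt_irrefl _ hI.1
  · exact lt_irrefl _ hI.2
  · apply hnot
    rcases Nat.eq_zero_or_pos i with rfl | hi
    · refine Or.inl (Or.inl (h.mem_switchRegion_iff.mpr ?_))
      cases ε
      · obtain ⟨l, rfl⟩ : ∃ l, k = l + 1 := ⟨k - 1, by have := hz.2.2.2.1 rfl rfl; omega⟩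
        exact ⟨l, by have := hz.2.1; omega, (h.left_lt_right l).le, le_rfl⟩
      · exact ⟨k, hz.2.2.1 rfl rfl, le_rfl, (h.left_lt_right k).le⟩
    · rw [Set.union_assoc, h.points]
      refine Or.inr ⟨ε, i - 1, by have := hz.1; omega, ?_⟩
      have h1 := h.eval_pt_digit ε (i - 1)
      rw [Nat.sub_add_cancel hi] at h1
      rw [hz.2.2.2.2 hi, h1]

lemma lastIndex_lt (h : IsGraphBase M n w q) (ε : Bool) : lastIndex M n w ε < M := by
  have h1 := h.last_pos
  have h2 := h.digit_le (n - 1)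
  cases ε <;> simp only [lastIndex] <;> omega

lemma exists_eval_eq (h : IsGraphBase M n w q) (ε : Bool) {i : ℕ} (hi : i < n) :
    ∃ z, Valid M n w z ∧ eval M w q z = orbitPt M w q ε i := by
  by_cases hin : i + 1 < n
  · exact ⟨_, valid_pt_digit h.digit_le ε hin, h.eval_pt_digit ε i⟩
  · obtain rfl : i = n - 1 := by omega
    rcases h.last ε with h1 | h1
    · exact ⟨_, valid_left h.pos (h.lastIndex_lt ε), h1.symm⟩
    · exact ⟨_, valid_right h.pos (h.lastIndex_lt ε), h1.symm⟩

lemma Ioo_subset (h : IsGraphBase M n w q) {x y : Label} (hxy : IsVertexPair M n w q x y) :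
    Set.Ioo (eval M w q x) (eval M w q y) ⊆ vertexRegion M q := by
  intro p hp
  refine ⟨⟨(h.eval_nonneg hxy.valid_left).trans_lt hp.1,
    hp.2.trans_le (h.eval_le_top hxy.valid_right)⟩, ?_⟩
  rw [Set.union_assoc, h.points]
  rintro (hS | ⟨ε, i, hi, rfl⟩)
  · obtain ⟨k, hk, h1, h2⟩ := h.mem_switchRegion_iff.mp hS
    have h3 : eval M w q (switchLeft k) ≤ eval M w q x := by
      by_contra hlt
      have := hxy.not_between _ (valid_left h.pos hk) (not_le.mp hlt)
      linarith [hp.2]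
    rcases h3.eq_or_lt with h4 | h4
    · exact hxy.ne_left k hk h4.symm
    · have := h.not_between hk hxy.valid_left h4
      linarith [hp.1]
  · obtain ⟨z, hz, hzi⟩ := h.exists_eval_eq ε hi
    rw [← hzi] at hp
    exact absurd (hxy.not_between z hz hp.1) (not_le.mpr hp.2)

lemma component_eq (h : IsGraphBase M n w q) {x y : Label} (hxy : IsVertexPair M n w q x y)
    {p : ℝ} (hp : p ∈ Set.Ioo (eval M w q x) (eval M w q y)) :
    connectedComponentIn (vertexRegion M q) p = Set.Ioo (eval M w q x) (eval M w q y) :=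
  connectedComponentIn_eq_Ioo (h.Ioo_subset hxy) (h.eval_notMem hxy.valid_left)
    (h.eval_notMem hxy.valid_right) hp

lemma exists_pred {p : ℝ} {z : Label} (hz : Valid M n w z) (hzp : eval M w q z < p) :
    ∃ x, Valid M n w x ∧ eval M w q x < p ∧
      ∀ z, Valid M n w z → eval M w q z < p → eval M w q z ≤ eval M w q x := by
  obtain ⟨x, hx, hmax⟩ := Set.exists_max_image {x | Valid M n w x ∧ eval M w q x < p}
    (eval M w q) (finite_valid.subset fun x hx => hx.1) ⟨z, hz, hzp⟩
  exact ⟨x, hx.1, hx.2, fun z hz hzp => hmax z ⟨hz, hzp⟩⟩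

lemma exists_succ {p : ℝ} {z : Label} (hz : Valid M n w z) (hzp : p < eval M w q z) :
    ∃ y, Valid M n w y ∧ p < eval M w q y ∧
      ∀ z, Valid M n w z → p < eval M w q z → eval M w q y ≤ eval M w q z := by
  obtain ⟨x, hx, hmin⟩ := Set.exists_min_image {x | Valid M n w x ∧ p < eval M w q x}
    (eval M w q) (finite_valid.subset fun x hx => hx.1) ⟨z, hz, hzp⟩
  exact ⟨x, hx.1, hx.2, fun z hz hzp => hmin z ⟨hz, hzp⟩⟩

lemma exists_pair (h : IsGraphBase M n w q) {p : ℝ} (hp : p ∈ vertexRegion M q) :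
    ∃ x y, IsVertexPair M n w q x y ∧ p ∈ Set.Ioo (eval M w q x) (eval M w q y) := by
  obtain ⟨x, hx, hxp, hmax⟩ := exists_pred (M := M) (n := n) (w := w) (q := q) (p := p)
    (z := bot) trivial hp.1.1
  obtain ⟨y, hy, hyp, hmin⟩ := exists_succ (M := M) (n := n) (w := w) (q := q) (p := p)
    (z := top) trivial hp.1.2
  have hne : ∀ z, Valid M n w z → eval M w q z ≠ p := fun z hz hzp =>
    h.eval_notMem hz (hzp ▸ hp)
  refine ⟨x, y, ⟨hx, hy, hxp.trans hyp, fun z hz hxz => ?_, fun k hk hxk => ?_⟩, hxp, hyp⟩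
  · rcases lt_or_gt_of_ne (hne z hz) with h1 | h1
    · exact absurd (hmax z hz h1) (not_le.mpr hxz)
    · exact hmin z hz h1
  · refine hp.2 (Or.inl (Or.inl (h.mem_switchRegion_iff.mpr ⟨k, hk, hxk ▸ hxp.le, ?_⟩)))
    by_contra hlt
    have h1 := hmax _ (valid_right h.pos hk) (not_le.mp hlt)
    rw [hxk] at h1
    exact absurd h1 (not_le.mpr (h.left_lt_right k))

lemma vertex_spec (h : IsGraphBase M n w q) (I : (graph M q).Vertex) :
    ∃ x y, IsVertexPair M n w q x y ∧ I.1 = Set.Ioo (eval M w q x) (eval M w q y) := by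
  obtain ⟨C, p, hp, rfl⟩ := I
  obtain ⟨x, y, hxy, hpm⟩ := h.exists_pair hp
  exact ⟨x, y, hxy, h.component_eq hxy hpm⟩

lemma exists_vertex (h : IsGraphBase M n w q) {x y : Label} (hxy : IsVertexPair M n w q x y) :
    ∃ I : (graph M q).Vertex, I.1 = Set.Ioo (eval M w q x) (eval M w q y) := by
  obtain ⟨p, hp⟩ := Set.nonempty_Ioo.mpr hxy.lt
  exact ⟨⟨_, p, h.Ioo_subset hxy hp, rfl⟩, h.component_eq hxy hp⟩

lemma exists_pair_right {x : Label} (hx : Valid M n w x)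
    (hxt : eval M w q x < (M : ℝ) / (q - 1))
    (hxl : ∀ k < M, eval M w q x ≠ eval M w q (switchLeft k)) :
    ∃ y, IsVertexPair M n w q x y := by
  obtain ⟨y, hy, hxy, hmin⟩ := exists_succ (M := M) (n := n) (w := w) (q := q) (z := top)
    trivial hxt
  exact ⟨y, hx, hy, hxy, hmin, hxl⟩

lemma exists_pair_left (h : IsGraphBase M n w q) {y : Label} (hy : Valid M n w y)
    (hy0 : 0 < eval M w q y)
    (hyl : ∀ k < M, eval M w q (switchLeft k) < eval M w q y →
      eval M w q (switchRight k) < eval M w q y) :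
    ∃ x, IsVertexPair M n w q x y := by
  obtain ⟨x, hx, hxy, hmax⟩ := exists_pred (M := M) (n := n) (w := w) (q := q) (z := bot)
    trivial hy0
  refine ⟨x, hx, hy, hxy, fun z hz hxz => ?_, fun k hk hxk => ?_⟩
  · by_contra hlt
    exact absurd (hmax z hz (not_le.mp hlt)) (not_le.mpr hxz)
  · have h1 := hmax _ (valid_right h.pos hk) (hyl k hk (hxk ▸ hxy))
    rw [hxk] at h1
    exact absurd h1 (not_le.mpr (h.left_lt_right k))

/-- The top point and the left ends of switch intervals close a vertex on their left; every other
named point opens one on its right. -/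
lemma endpoints_eq (h : IsGraphBase M n w q) :
    endpoints M q = eval M w q '' {x | Valid M n w x} := by
  ext p
  constructor
  · rintro ⟨I, hI⟩
    obtain ⟨x, y, hxy, hI'⟩ := h.vertex_spec I
    rw [hI'] at hI
    rcases hI with hI | hI
    · exact ⟨x, hxy.valid_left, (isGLB_Ioo hxy.lt).unique hI⟩
    · exact ⟨y, hxy.valid_right, (isLUB_Ioo hxy.lt).unique hI⟩
  · rintro ⟨z, hz, rfl⟩
    have hleft : (∃ y, IsVertexPair M n w q z y) → eval M w q z ∈ endpoints M q := by
      rintro ⟨y, hzy⟩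
      obtain ⟨I, hI⟩ := h.exists_vertex hzy
      exact ⟨I, Or.inl (hI ▸ isGLB_Ioo hzy.lt)⟩
    have hright : (∃ x, IsVertexPair M n w q x z) → eval M w q z ∈ endpoints M q := by
      rintro ⟨x, hxz⟩
      obtain ⟨I, hI⟩ := h.exists_vertex hxz
      exact ⟨I, Or.inr (hI ▸ isLUB_Ioo hxz.lt)⟩
    have htop := h.one_lt_top
    rcases (h.eval_le_top hz).eq_or_lt with ht | ht
    · refine hright (h.exists_pair_left hz (by rw [ht]; linarith) fun k hk _ => ?_)
      rw [ht]
      exact h.eval_pt_lt_top (valid_right h.pos hk)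
    · by_cases hl : ∃ k < M, eval M w q z = eval M w q (switchLeft k)
      · obtain ⟨k, hk, hzk⟩ := hl
        refine hright (h.exists_pair_left hz ?_ fun l hl hlk => ?_)
        · rw [hzk]
          exact h.eval_pt_pos (valid_left h.pos hk)
        · rw [hzk] at hlk ⊢
          refine lt_of_le_of_ne (h.not_between hl (valid_left h.pos hk) hlk) fun heq => ?_
          rcases lt_trichotomy l k with hkl | rfl | hkl
          · exact (h.right_lt_left hkl).ne heq
          · exact lt_irrefl _ hlk
          · linarith [h.right_lt_left hkl, h.left_lt_right k]
      · push Not at hl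
        exact hleft (exists_pair_right hz ht hl)

/-! ### Edges in terms of names -/

lemma valid_imageLeft (h : IsGraphBase M n w q) (ε : Bool) (i : ℕ) :
    Valid M n w (imageLeft M n w ε i) := by
  rw [imageLeft]
  split_ifs with hi
  · exact valid_pt_digit h.digit_le ε hi
  · exact valid_right h.pos (h.lastIndex_lt ε)

lemma valid_imageRight (h : IsGraphBase M n w q) (ε : Bool) (i : ℕ) :
    Valid M n w (imageRight M n w ε i) := by
  rw [imageRight]
  split_ifs with hi
  · exact valid_pt_digit h.digit_le ε hi
  · exact valid_left h.pos (h.lastIndex_lt ε)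

/-- Only the last orbit point needs an argument: it may be either end of a switch interval. Since u
is neither the left end nor an interior point of it, lying above one end is the same as lying above
the other. -/
lemma orbitPt_le_eval_iff (h : IsGraphBase M n w q) {u v : Label}
    (huv : IsVertexPair M n w q u v) (ε : Bool) {i : ℕ} (hi : i < n) :
    orbitPt M w q ε i ≤ eval M w q u ↔ eval M w q (imageLeft M n w ε i) ≤ eval M w q u := by
  rw [imageLeft]
  split_ifs with hin
  · rw [h.eval_pt_digit]
  · obtain rfl : i = n - 1 := by omega
    have hk := h.lastIndex_lt ε
    rcases h.last ε with h1 | h1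
    · rw [h1]
      refine ⟨fun hle => ?_, fun hle => (h.left_lt_right _).le.trans hle⟩
      exact h.not_between hk huv.valid_left (lt_of_le_of_ne hle (huv.ne_left _ hk).symm)
    · rw [h1]

lemma eval_le_orbitPt_iff (h : IsGraphBase M n w q) {u v : Label}
    (huv : IsVertexPair M n w q u v) (ε : Bool) {i : ℕ} (hi : i < n) :
    eval M w q v ≤ orbitPt M w q ε i ↔ eval M w q v ≤ eval M w q (imageRight M n w ε i) := by
  rw [imageRight]
  split_ifs with hin
  · rw [h.eval_pt_digit]
  · obtain rfl : i = n - 1 := by omega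
    have hk := h.lastIndex_lt ε
    rcases h.last ε with h1 | h1
    · rw [h1]
    · rw [h1]
      refine ⟨fun hle => ?_, fun hle => hle.trans (h.left_lt_right _).le⟩
      by_contra hlt
      have h2 := h.not_between hk huv.valid_right (not_le.mp hlt)
      exact huv.ne_right h.toIsWordBase hk (le_antisymm hle h2)

lemma mul_eval_pt (h : IsGraphBase M n w q) (k : ℕ) (ε : Bool) (i : ℕ) :
    q * eval M w q (pt k ε i) = k + orbitPt M w q ε i :=
  mul_div_cancel₀ _ h.q_pos.ne'

/-- Orbit points lie in [M/(q-1) - 1, 1]. So for j ≠ k the image of `pt j ε i` is outside (0,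
M/(q-1)), on the side given by the sign of j - k, and only j = k requires a comparison. -/
lemma lower_iff (h : IsGraphBase M n w q) {x y u v : Label} (hxy : IsVertexPair M n w q x y)
    (huv : IsVertexPair M n w q u v) (k : ℕ) :
    q * eval M w q x - k ≤ eval M w q u ↔ x = bot ∨ ∃ j ε i, x = pt j ε i ∧
      (j < k ∨ j = k ∧ eval M w q (imageLeft M n w ε i) ≤ eval M w q u) := by
  have hu0 := h.eval_nonneg huv.valid_left
  have hut := huv.lt.trans_le (h.eval_le_top huv.valid_right)
  rcases x with _ | _ | ⟨j, ε, i⟩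
  · refine iff_of_true ?_ (Or.inl rfl)
    change q * 0 - (k : ℝ) ≤ _
    linarith [Nat.cast_nonneg (α := ℝ) k]
  · exact absurd (hxy.lt.trans_le (h.eval_le_top hxy.valid_right)) (lt_irrefl _)
  · have h1 := h.le_orbitPt ε hxy.valid_left.1
    have h2 := h.orbitPt_le ε hxy.valid_left.1
    rw [h.mul_eval_pt]
    simp only [reduceCtorEq, false_or, Label.pt.injEq]
    rcases lt_trichotomy j k with hjk | rfl | hjk
    · have : (j : ℝ) + 1 ≤ k := by exact_mod_cast hjk
      exact iff_of_true (by linarith) ⟨j, ε, i, ⟨rfl, rfl, rfl⟩, Or.inl hjk⟩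
    · rw [add_sub_cancel_left, h.orbitPt_le_eval_iff huv ε hxy.valid_left.1]
      constructor
      · intro hle
        exact ⟨_, _, _, ⟨rfl, rfl, rfl⟩, Or.inr ⟨rfl, hle⟩⟩
      · rintro ⟨_, _, _, ⟨rfl, rfl, rfl⟩, h3 | h3⟩
        · exact absurd h3 (lt_irrefl _)
        · exact h3.2
    · have : (k : ℝ) + 1 ≤ j := by exact_mod_cast hjk
      refine iff_of_false (by intro; linarith) ?_
      rintro ⟨_, _, _, ⟨rfl, rfl, rfl⟩, h3 | h3⟩ <;> omega

lemma upper_iff (h : IsGraphBase M n w q) {x y u v : Label} (hxy : IsVertexPair M n w q x y)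
    (huv : IsVertexPair M n w q u v) {k : ℕ} (hk : k ≤ M) :
    eval M w q v ≤ q * eval M w q y - k ↔ y = top ∨ ∃ j ε i, y = pt j ε i ∧
      (k < j ∨ j = k ∧ eval M w q v ≤ eval M w q (imageRight M n w ε i)) := by
  have hv0 := (h.eval_nonneg huv.valid_left).trans_lt huv.lt
  have hvt := h.eval_le_top huv.valid_right
  rcases y with _ | _ | ⟨j, ε, i⟩
  · exact absurd ((h.eval_nonneg hxy.valid_left).trans_lt hxy.lt) (lt_irrefl _)
  · refine iff_of_true ?_ (Or.inl rfl)
    change _ ≤ q * ((M : ℝ) / (q - 1)) - (k : ℝ)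
    have : (k : ℝ) ≤ M := by exact_mod_cast hk
    rw [mul_top h.one_lt]
    linarith
  · have h1 := h.le_orbitPt ε hxy.valid_right.1
    have h2 := h.orbitPt_le ε hxy.valid_right.1
    rw [h.mul_eval_pt]
    simp only [reduceCtorEq, false_or, Label.pt.injEq]
    rcases lt_trichotomy j k with hjk | rfl | hjk
    · have : (j : ℝ) + 1 ≤ k := by exact_mod_cast hjk
      refine iff_of_false (by intro; linarith) ?_
      rintro ⟨_, _, _, ⟨rfl, rfl, rfl⟩, h3 | h3⟩ <;> omega
    · rw [add_sub_cancel_left, h.eval_le_orbitPt_iff huv ε hxy.valid_right.1]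
      constructor
      · intro hle
        exact ⟨_, _, _, ⟨rfl, rfl, rfl⟩, Or.inr ⟨rfl, hle⟩⟩
      · rintro ⟨_, _, _, ⟨rfl, rfl, rfl⟩, h3 | h3⟩
        · exact absurd h3 (lt_irrefl _)
        · exact h3.2
    · have : (k : ℝ) + 1 ≤ j := by exact_mod_cast hjk
      exact iff_of_true (by linarith) ⟨j, ε, i, ⟨rfl, rfl, rfl⟩, Or.inl hjk⟩

/-- The base enters the criterion only through comparisons of named points, so it can be carried
over to another base with the same order. -/
lemma edge_iff (h : IsGraphBase M n w q) {I J : (graph M q).Vertex} {x y u v : Label}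
    (hxy : IsVertexPair M n w q x y) (huv : IsVertexPair M n w q u v)
    (hI : I.1 = Set.Ioo (eval M w q x) (eval M w q y))
    (hJ : J.1 = Set.Ioo (eval M w q u) (eval M w q v)) (k : Fin (M + 1)) :
    (graph M q).Edge I k J ↔
      (x = bot ∨ ∃ j ε i, x = pt j ε i ∧
        (j < k ∨ j = k ∧ eval M w q (imageLeft M n w ε i) ≤ eval M w q u)) ∧
      (y = top ∨ ∃ j ε i, y = pt j ε i ∧
        ((k : ℕ) < j ∨ j = k ∧ eval M w q v ≤ eval M w q (imageRight M n w ε i))) := by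
  change J.1 ⊆ (fun z : ℝ => q * z - ((k : ℕ) : ℝ)) '' I.1 ↔ _
  have himg : (fun z : ℝ => q * z - ((k : ℕ) : ℝ)) '' I.1
      = Set.Ioo (q * eval M w q x - (k : ℕ)) (q * eval M w q y - (k : ℕ)) := by
    rw [hI]
    simpa [sub_eq_add_neg] using
      Set.image_affine_Ioo h.q_pos (-((k : ℕ) : ℝ)) (eval M w q x) (eval M w q y)
  rw [himg, hJ, Set.Ioo_subset_Ioo_iff huv.lt, h.lower_iff hxy huv,
    h.upper_iff hxy huv (Nat.lt_succ_iff.mp k.2)]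

end IsGraphBase

/-! ### The isomorphism -/

lemma exists_orderIso_image {Λ : Type*} {V : Set Λ} {e₀ e₁ : Λ → ℝ} {E₀ E₁ : Set ℝ}
    (hE₀ : E₀ = e₀ '' V) (hE₁ : E₁ = e₁ '' V)
    (hle : ∀ x ∈ V, ∀ y ∈ V, (e₀ x ≤ e₀ y ↔ e₁ x ≤ e₁ y)) :
    ∃ f : E₀ ≃o E₁, ∀ (a : E₀), ∀ x ∈ V, (a : ℝ) = e₀ x → (f a : ℝ) = e₁ x := by
  subst hE₀ hE₁
  -- A point may have several names; by `heq` below, the choice does not affect its image.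
  choose g hg hge using fun a : e₀ '' V => a.2
  have hlt : ∀ x ∈ V, ∀ y ∈ V, (e₀ x < e₀ y ↔ e₁ x < e₁ y) := fun x hx y hy => by
    rw [← not_le, ← not_le, hle y hy x hx]
  have heq : ∀ x ∈ V, ∀ y ∈ V, e₀ x = e₀ y → e₁ x = e₁ y := fun x hx y hy h =>
    le_antisymm ((hle x hx y hy).mp h.le) ((hle y hy x hx).mp h.ge)
  let F : e₀ '' V → e₁ '' V := fun a => ⟨e₁ (g a), g a, hg a, rfl⟩
  have hmono : StrictMono F := fun a b hab => by
    have : (a : ℝ) < b := hab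
    rw [← hge a, ← hge b] at this
    exact (hlt _ (hg a) _ (hg b)).mp this
  have hsurj : Function.Surjective F := by
    rintro ⟨_, x, hx, rfl⟩
    exact ⟨⟨e₀ x, x, hx, rfl⟩, Subtype.ext (heq _ (hg _) _ hx (hge _))⟩
  refine ⟨hmono.orderIsoOfSurjective F hsurj, fun a x hx hax => ?_⟩
  exact heq _ (hg a) _ hx ((hge a).trans hax)

lemma Ioo_eq_Ioo_iff {a b c d : ℝ} (h : a < b) (h' : c < d) :
    Set.Ioo a b = Set.Ioo c d ↔ a = c ∧ b = d := by
  refine ⟨fun heq => ⟨?_, ?_⟩, fun ⟨h1, h2⟩ => by rw [h1, h2]⟩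
  · exact (heq ▸ isGLB_Ioo h : IsGLB (Set.Ioo c d) a).unique (isGLB_Ioo h')
  · exact (heq ▸ isLUB_Ioo h : IsLUB (Set.Ioo c d) b).unique (isLUB_Ioo h')

/-- Two bases for which the labels are ordered in the same way have isomorphic graphs. -/
theorem exists_iso_of_eval_le_iff {q₀ q₁ : ℝ} (h₀ : IsGraphBase M n w q₀)
    (h₁ : IsGraphBase M n w q₁)
    (hle : ∀ x, Valid M n w x → ∀ y, Valid M n w y →
      (eval M w q₀ x ≤ eval M w q₀ y ↔ eval M w q₁ x ≤ eval M w q₁ y)) :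
    ∃ (f : endpoints M q₀ ≃o endpoints M q₁) (F : LabeledGraph.Iso (graph M q₀) (graph M q₁)),
      ∀ I : (graph M q₀).Vertex, ∃ x y : endpoints M q₀, x < y ∧
        I.1 = Set.Ioo (x : ℝ) (y : ℝ) ∧ (F.toEquiv I).1 = Set.Ioo (f x : ℝ) (f y : ℝ) := by
  have hlt : ∀ x, Valid M n w x → ∀ y, Valid M n w y →
      (eval M w q₀ x < eval M w q₀ y ↔ eval M w q₁ x < eval M w q₁ y) := fun x hx y hy => by
    rw [← not_le, ← not_le, hle y hy x hx]
  have heq : ∀ x, Valid M n w x → ∀ y, Valid M n w y →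
      (eval M w q₀ x = eval M w q₀ y ↔ eval M w q₁ x = eval M w q₁ y) := fun x hx y hy => by
    rw [le_antisymm_iff, le_antisymm_iff, hle x hx y hy, hle y hy x hx]
  have hpair : ∀ x y, IsVertexPair M n w q₀ x y ↔ IsVertexPair M n w q₁ x y := by
    intro x y
    constructor
    · rintro ⟨hx, hy, hxy, hb, hn⟩
      exact ⟨hx, hy, (hlt x hx y hy).mp hxy,
        fun z hz hxz => (hle y hy z hz).mp (hb z hz ((hlt x hx z hz).mpr hxz)),
        fun k hk hxk => hn k hk ((heq x hx _ (valid_left h₀.pos hk)).mpr hxk)⟩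
    · rintro ⟨hx, hy, hxy, hb, hn⟩
      exact ⟨hx, hy, (hlt x hx y hy).mpr hxy,
        fun z hz hxz => (hle y hy z hz).mpr (hb z hz ((hlt x hx z hz).mp hxz)),
        fun k hk hxk => hn k hk ((heq x hx _ (valid_left h₀.pos hk)).mp hxk)⟩
  obtain ⟨f, hf⟩ := exists_orderIso_image h₀.endpoints_eq h₁.endpoints_eq hle
  choose x y hxy hI using h₀.vertex_spec
  choose φ hφ using fun I => h₁.exists_vertex ((hpair _ _).mp (hxy I))
  have hinj : Function.Injective φ := by
    intro I J hIJ
    have h2 : (φ I).1 = (φ J).1 := by rw [hIJ]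
    rw [hφ, hφ, Ioo_eq_Ioo_iff ((hpair _ _).mp (hxy I)).lt ((hpair _ _).mp (hxy J)).lt,
      ← heq _ (hxy I).valid_left _ (hxy J).valid_left,
      ← heq _ (hxy I).valid_right _ (hxy J).valid_right] at h2
    refine Subtype.ext ?_
    rw [hI, hI J, h2.1, h2.2]
  have hsurj : Function.Surjective φ := by
    intro J
    obtain ⟨u, v, huv, hJ⟩ := h₁.vertex_spec J
    have huv₀ := (hpair _ _).mpr huv
    obtain ⟨I, hI'⟩ := h₀.exists_vertex huv₀
    refine ⟨I, Subtype.ext ?_⟩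
    have h2 := (hI I).symm.trans hI'
    rw [Ioo_eq_Ioo_iff (hxy I).lt huv₀.lt, heq _ (hxy I).valid_left _ huv₀.valid_left,
      heq _ (hxy I).valid_right _ huv₀.valid_right] at h2
    rw [hφ, hJ, h2.1, h2.2]
  refine ⟨f, ⟨Equiv.ofBijective φ ⟨hinj, hsurj⟩, fun I k J => ?_⟩, fun I => ?_⟩
  · have hxy₁ := (hpair _ _).mp (hxy I)
    have huv₁ := (hpair _ _).mp (hxy J)
    rw [h₀.edge_iff (hxy I) (hxy J) (hI I) (hI J)]
    refine Iff.trans ?_ (h₁.edge_iff hxy₁ huv₁ (hφ I) (hφ J) k).symm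
    simp only [hle _ (h₀.valid_imageLeft _ _) _ (hxy J).valid_left,
      hle _ (hxy J).valid_right _ (h₀.valid_imageRight _ _)]
  · have hx : eval M w q₀ (x I) ∈ endpoints M q₀ := by
      rw [h₀.endpoints_eq]; exact ⟨_, (hxy I).valid_left, rfl⟩
    have hy : eval M w q₀ (y I) ∈ endpoints M q₀ := by
      rw [h₀.endpoints_eq]; exact ⟨_, (hxy I).valid_right, rfl⟩
    refine ⟨⟨_, hx⟩, ⟨_, hy⟩, (hxy I).lt, hI I, ?_⟩
    rw [hf ⟨_, hx⟩ _ (hxy I).valid_left rfl, hf ⟨_, hy⟩ _ (hxy I).valid_right rfl]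
    exact hφ I

end Univoque

theorem theorem1p3 (M : ℕ) (hM : 1 ≤ M) (q₀ q₀s q₁ : ℝ)
    (hgap : Univoque.IsGap M q₀ q₀s) (hq₀ : 1 < q₀)
    (hq₁ : IsLeast (Univoque.setV M ∩ Set.Ioo q₀ q₀s) q₁) :
    ∃ (f : Univoque.endpoints M q₀ ≃o Univoque.endpoints M q₁)
      (F : Univoque.LabeledGraph.Iso (Univoque.graph M q₀) (Univoque.graph M q₁)),
      ∀ I : (Univoque.graph M q₀).Vertex,
        ∃ x y : Univoque.endpoints M q₀, x < y ∧
          I.1 = Set.Ioo (x : ℝ) (y : ℝ) ∧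
          (F.toEquiv I).1 = Set.Ioo (f x : ℝ) (f y : ℝ) := by
  obtain ⟨n, w, h₀, h₁, e₀, e₁⟩ := Univoque.exists_isWordBase_of_isGap hM hgap hq₀ hq₁
  exact Univoque.exists_iso_of_eval_le_iff (h₀.isGraphBase_of_orbit_eq_zero e₀)
    (h₁.isGraphBase_of_orbit_eq_reflect e₁) fun _ hx _ hy =>
      Univoque.eval_le_iff h₀ h₁ e₀ e₁ hx hy
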